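/- Let $N\ge 1$, $u_1<\dots<u_N$ real, and let $f:\mathbb R\to\mathbb R$ be $C^1$. Put $M_u=\mathrm{diag}(u_1,\dots,u_N)$, $M_f=\mathrm{diag}(f(u_1),\dots,f(u_N))$. Let $\mathfrak m$ be the Markov algebra of real $N\times N$ matrices with zero row sums. For a real matrix $A$ let $B=B(A)$ be the matrix with $B_{ij}=-\frac{f(u_i)-f(u_j)}{u_i-u_j}A_{ij}$ for $i\ne j$ and $B_{ii}=-\sum_{j\ne i}B_{ij}$. Consider continuous loops $X:\{|z|=1\}\to M_N(\mathbb C)$ with real Laurent coefficients, with pointwise operations, the supremum norm, and the pairing $\langle X|Y\rangle=\frac1{2\pi i}\oint_{|z|=1}\mathrm{Tr}(X(z)Y(z))\frac{dz}{z}$. Let $LG_+$ be the group of such loops that extend continuously to $|z|\le 1$ and holomorphically to $|z|<1$ with invertible values, the value at $z=0$ having all row sums equal to $1$. Let $LG_-$ be the group of such loops that extend continuously to $1\le|z|\le\infty$ and holomorphically to $1<|z|\le\infty$ with invertible values, the value at $z=\infty$ being diagonal. Write $\mathrm{Ad}_gX=gXg^{-1}$. Let $\varphi(s)=\sum_{n\ge0}a_ns^n$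 be an entire function with real coefficients such that $\varphi(u_i)=f(u_i)$ for all $i$ (for instance $\varphi=f$ if $f$ is a polynomial, or the restriction to $\mathbb R$ of an entire function; for every $f$ such a $\varphi$ exists by interpolation), let $F(s)=\int_0^s\varphi(r)\,dr$, and let $H_F(X)=\langle F(z^{-1}X)\,|\,z^2\rangle$. Let $A_0\in\mathfrak m$ and $X_0(z)=zM_u-A_0$. Then: 1. $H_F$ has a unique gradient $G=\nabla H_F(X_0)$ at $X_0$, that is, a unique loop $G$ with $\langle G|Y\rangle=\frac{d}{d\tau}H_F(X_0+\tau Y)|_{\tau=0}$ for all $Y$. 2. There are an open interval $I\ni0$ and smooth curves $g_\pm:I\to LG_\pm$ with $$\exp\big(t\,\nabla H_F(X_0)\big)=g_+(t)^{-1}g_-(t)\quad(t\in I),\qquad g_\pm(0)=\mathrm{Id},$$ which are maximal: any other smooth solution of this factorization problem on an open interval $J\ni 0$ satisfies $J\subseteq I$ and is the restriction of $g_\pm$ to $J$. 3. For this solution (and for any smooth solution of the factorization problem on an open interval $I\ni 0$) there is a curve $A:I\to\mathfrak m$ with $A(0)=A_0$ that solves $$\frac{d}{dt}(A-zM_u)=[A-zM_u,\,B+zM_f]\qquad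 (z\in\mathbb C,\ B=B(A)),$$ and $X_t(z)=zM_u-A(t)$ is given by $$X_t=\mathrm{Ad}_{g_+(t)}X_0=\mathrm{Ad}_{g_-(t)}X_0,\qquad t\in I.$$ Moreover $A$ is the solution: every real matrix solution $A'$ of this equation on an open interval $J\ni0$ with $A'(0)=A_0$ agrees with $A$ on $I\cap J$. -/

import Mathlib

open scoped Matrix ContDiff

noncomputable section

namespace MarkovLax

/-! ### The norm on complex matrices

The operator norm of the maximum norm on `ℂ ^ N`, put on top of Mathlib's uniform structure on
matrices. All norms being equivalent, nothing below depends on this choice. -/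

instance matrixNormedRing {N : ℕ} : NormedRing (Matrix (Fin N) (Fin N) ℂ) :=
  letI L : NormedRing (Matrix (Fin N) (Fin N) ℂ) := Matrix.linftyOpNormedRing
  { (inferInstance : Ring (Matrix (Fin N) (Fin N) ℂ)),
    L.toMetricSpace.replaceUniformity (U := Matrix.instUniformSpace (Fin N) (Fin N) ℂ) rfl with
    norm := L.norm
    dist_eq := L.dist_eq
    norm_mul_le := L.norm_mul_le }

instance matrixNormedAlgebra {N : ℕ} (𝕜 : Type*) [NormedField 𝕜] [NormedAlgebra 𝕜 ℂ] :
    NormedAlgebra 𝕜 (Matrix (Fin N) (Fin N) ℂ) :=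
  { (inferInstance : Algebra 𝕜 (Matrix (Fin N) (Fin N) ℂ)) with
    norm_smul_le :=
      (Matrix.linftyOpNormedAlgebra (R := 𝕜) (n := Fin N) (α := ℂ)).norm_smul_le }

/-! ### The Markov algebra and the discrete Lax equation -/

/-- The Markov algebra: real `N × N` matrices all of whose row sums vanish. -/
def markovAlgebra (N : ℕ) : Submodule ℝ (Matrix (Fin N) (Fin N) ℝ) where
  carrier := {A | ∀ i, ∑ j, A i j = 0}
  add_mem' := by
    intro A B hA hB i
    have h1 := hA i
    have h2 := hB i
    simp [Finset.sum_add_distrib, h1, h2]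
  zero_mem' := by intro i; simp
  smul_mem' := by
    intro c A hA i
    have h1 := hA i
    simp [← Finset.mul_sum, h1]

variable {N : ℕ}

/-- The symmetric matrix `F` of (negative) shock speeds of the flux `f`. -/
def speedMatrix (u : Fin N → ℝ) (f : ℝ → ℝ) : Matrix (Fin N) (Fin N) ℝ :=
  Matrix.of fun i j =>
    if i = j then -deriv f (u i) else -((f (u i) - f (u j)) / (u i - u j))

/-- The matrix `B` attached to `A`: `B i j = F i j * A i j` off the diagonal, zero row sums. -/
def companion (u : Fin N → ℝ) (f : ℝ → ℝ) (A : Matrix (Fin N) (Fin N) ℝ) :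
    Matrix (Fin N) (Fin N) ℝ :=
  Matrix.of fun i j =>
    if i = j then -∑ k ∈ Finset.univ.erase i, speedMatrix u f i k * A i k
    else speedMatrix u f i j * A i j

/-- A real matrix regarded as a complex matrix. -/
def toComplex (A : Matrix (Fin N) (Fin N) ℝ) : Matrix (Fin N) (Fin N) ℂ :=
  A.map Complex.ofReal

/-- `Mu u = diag (u_1, …, u_N)`; the matrix `M_f` is `Mu (f ∘ u)`. -/
def Mu (u : Fin N → ℝ) : Matrix (Fin N) (Fin N) ℂ :=
  Matrix.diagonal fun i => (u i : ℂ)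

/-- `A` solves `d/dt (A - z M_u) = [A - z M_u, B + z M_f]` at all times in `I`, for all `z ∈ ℂ`. -/
def IsLaxSolution (u : Fin N → ℝ) (f : ℝ → ℝ) (I : Set ℝ)
    (A : ℝ → Matrix (Fin N) (Fin N) ℝ) : Prop :=
  ∀ t ∈ I, ∀ z : ℂ,
    HasDerivAt (fun s => toComplex (A s) - z • Mu u)
      ⁅toComplex (A t) - z • Mu u, toComplex (companion u f (A t)) + z • Mu (f ∘ u)⁆ t

/-! ### Loops on the circle `|z| = 1` -/

/-- Continuous matrix-valued loops `X(z)`, `|z| = 1`: a Banach algebra under pointwise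
multiplication and the supremum norm. -/
abbrev Loop (N : ℕ) := C(Circle, Matrix (Fin N) (Fin N) ℂ)

/-- The loop has real Laurent (Fourier) coefficients, i.e. `X(z̄)` is the entrywise complex
conjugate of `X(z)`. -/
def IsRealLoop (X : Loop N) : Prop :=
  ∀ z : Circle, X z⁻¹ = (starRingEnd ℂ).mapMatrix (X z)

/-- The scalar loop `z ^ k • Id`. -/
def zpowLoop (N : ℕ) (k : ℤ) : Loop N where
  toFun z := ((z ^ k : Circle) : ℂ) • (1 : Matrix (Fin N) (Fin N) ℂ)
  continuous_toFun := by
    have h : Continuous fun z : Circle => ((z ^ k : Circle) : ℂ) :=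
      continuous_subtype_val.comp (continuous_zpow k)
    exact h.smul continuous_const

/-- The loop `X(z) = z M_u - A`. -/
def laxLoop (u : Fin N → ℝ) (A : Matrix (Fin N) (Fin N) ℝ) : Loop N where
  toFun z := (z : ℂ) • Mu u - toComplex A
  continuous_toFun := by fun_prop

/-- `⟨X | Y⟩ = (2πi)⁻¹ ∮_{|z|=1} Tr (X(z) Y(z)) dz / z`, with `z = exp (iθ)`. -/
def pairing (X Y : Loop N) : ℂ :=
  (2 * (Real.pi : ℂ))⁻¹ *
    ∫ θ in (0 : ℝ)..(2 * Real.pi), (X (Circle.exp θ) * Y (Circle.exp θ)).trace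

/-- The value at the loop `X` of the entire function with Taylor coefficients `a`. -/
def entireEval (a : ℕ → ℝ) (X : Loop N) : Loop N :=
  ∑' n, a n • X ^ n

/-- Taylor coefficients of the antiderivative `F(s) = ∫_0^s φ`, where `φ(s) = ∑ a n s ^ n`. -/
def antiderivCoeff (a : ℕ → ℝ) : ℕ → ℝ
  | 0 => 0
  | n + 1 => a n / (n + 1)

/-- The Hamiltonian `H_F(X) = ⟨F(X z⁻¹) | z²⟩`, where `F' = φ` and `φ(s) = ∑ a n s ^ n`. -/
def hamiltonian (a : ℕ → ℝ) (X : Loop N) : ℂ :=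
  pairing (entireEval (antiderivCoeff a) (X * zpowLoop N (-1))) (zpowLoop N 2)

/-- `G` is the gradient at `X` of `H` with respect to the pairing:
`⟨G | Y⟩ = d/dτ H(X + τ Y)` at `τ = 0` for every `Y` in the (real) loop algebra. -/
def IsGradientAt (H : Loop N → ℂ) (X G : Loop N) : Prop :=
  IsRealLoop G ∧ ∀ Y : Loop N, IsRealLoop Y →
    HasDerivAt (fun τ : ℝ => H (X + τ • Y)) (pairing G Y) 0

/-! ### The loop subgroups -/

/-- `E` is continuous on the closed unit disc with invertible values, and holomorphic inside. -/
def IsGroupDisc (E : ℂ → Matrix (Fin N) (Fin N) ℂ) : Prop :=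
  DiffContOnCl ℂ E (Metric.ball 0 1) ∧ ∀ z ∈ Metric.closedBall (0 : ℂ) 1, IsUnit (E z)

lemma IsGroupDisc.one : IsGroupDisc (fun _ => (1 : Matrix (Fin N) (Fin N) ℂ)) :=
  ⟨diffContOnCl_const, fun _ _ => isUnit_one⟩

lemma IsGroupDisc.mul {E E' : ℂ → Matrix (Fin N) (Fin N) ℂ} (h : IsGroupDisc E)
    (h' : IsGroupDisc E') : IsGroupDisc (fun z => E z * E' z) :=
  ⟨⟨h.1.1.mul h'.1.1, h.1.2.mul h'.1.2⟩, fun z hz => (h.2 z hz).mul (h'.2 z hz)⟩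

lemma IsGroupDisc.inverse {E : ℂ → Matrix (Fin N) (Fin N) ℂ} (h : IsGroupDisc E) :
    IsGroupDisc (fun z => Ring.inverse (E z)) := by
  have hcl : closure (Metric.ball (0 : ℂ) 1) = Metric.closedBall 0 1 :=
    closure_ball 0 one_ne_zero
  refine ⟨⟨fun z hz => ?_, fun z hz => ?_⟩, fun z hz => ?_⟩
  · obtain ⟨U, hU⟩ := h.2 z (Metric.ball_subset_closedBall hz)
    have h1 : DifferentiableAt ℂ Ring.inverse (E z) := differentiableAt_inverse ⟨U, hU⟩
    exact h1.comp_differentiableWithinAt z (h.1.1 z hz)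
  · obtain ⟨U, hU⟩ := h.2 z (hcl ▸ hz)
    have h1 : ContinuousAt Ring.inverse (E z) := hU ▸ NormedRing.inverse_continuousAt U
    exact h1.comp_continuousWithinAt (h.1.2 z hz)
  · obtain ⟨U, hU⟩ := h.2 z hz
    exact ⟨U⁻¹, by simp only [← hU, Ring.inverse_unit]⟩

lemma coe_inv_apply (g : (Loop N)ˣ) (z : Circle) :
    ((g⁻¹ : (Loop N)ˣ) : Loop N) z = Ring.inverse ((g : Loop N) z) := by
  have h1 : (g : Loop N) z * ((g⁻¹ : (Loop N)ˣ) : Loop N) z = 1 := by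
    rw [← ContinuousMap.mul_apply, Units.mul_inv]; rfl
  have h2 : ((g⁻¹ : (Loop N)ˣ) : Loop N) z * (g : Loop N) z = 1 := by
    rw [← ContinuousMap.mul_apply, Units.inv_mul]; rfl
  exact (Ring.inverse_unit (⟨_, _, h1, h2⟩ : (Matrix (Fin N) (Fin N) ℂ)ˣ)).symm

/-- Invertible loops with real Laurent coefficients. -/
def loopGroup (N : ℕ) : Subgroup (Loop N)ˣ where
  carrier := {g | IsRealLoop (g : Loop N)}
  one_mem' := by intro z; simp
  mul_mem' := by
    intro g h hg hh z
    have h1 := hg z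
    have h2 := hh z
    simp only [Units.val_mul, ContinuousMap.mul_apply, map_mul, h1, h2]
  inv_mem' := by
    intro g hg z
    have h1 : (g : Loop N) z⁻¹ * (starRingEnd ℂ).mapMatrix (((g⁻¹ : (Loop N)ˣ) : Loop N) z) = 1 := by
      rw [hg z, ← map_mul, ← ContinuousMap.mul_apply, Units.mul_inv]
      simp
    have h2 : ((g⁻¹ : (Loop N)ˣ) : Loop N) z⁻¹ * (g : Loop N) z⁻¹ = 1 := by
      rw [← ContinuousMap.mul_apply, Units.inv_mul]; rfl
    exact left_inv_eq_right_inv h2 h1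

/-- The loop subgroup with Lie algebra `{∑_{k ≥ 0} A_k z ^ k | A_0 in the Markov algebra}`:
real loops that extend holomorphically, with invertible values, to `|z| < 1`, the value at `z = 0`
being in the Markov group (row sums equal to one). -/
def loopGroupPlus (N : ℕ) : Subgroup (Loop N)ˣ where
  carrier := {g | g ∈ loopGroup N ∧ ∃ E : ℂ → Matrix (Fin N) (Fin N) ℂ, IsGroupDisc E ∧
    (∀ z : Circle, E z = (g : Loop N) z) ∧ E 0 *ᵥ 1 = 1}
  one_mem' := ⟨one_mem _, _, IsGroupDisc.one, fun _ => rfl, by simp⟩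
  mul_mem' := by
    rintro g h ⟨hg, E, hE, hEg, hE0⟩ ⟨hh, E', hE', hEh, hE0'⟩
    refine ⟨mul_mem hg hh, _, hE.mul hE', fun z => ?_, ?_⟩
    · simp [hEg, hEh]
    · rw [← Matrix.mulVec_mulVec, hE0', hE0]
  inv_mem' := by
    rintro g ⟨hg, E, hE, hEg, hE0⟩
    refine ⟨inv_mem hg, _, hE.inverse, fun z => ?_, ?_⟩
    · rw [coe_inv_apply, hEg]
    · have h1 := Ring.inverse_mul_cancel _ (hE.2 0 (by simp))
      calc Ring.inverse (E 0) *ᵥ 1 = Ring.inverse (E 0) *ᵥ (E 0 *ᵥ 1) := by rw [hE0]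
        _ = 1 := by rw [Matrix.mulVec_mulVec, h1, Matrix.one_mulVec]

/-- The loop subgroup with Lie algebra `{∑_{k ≤ 0} A_k z ^ k | A_0 diagonal}`: real loops that
extend holomorphically, with invertible values, to `1 < |z| ≤ ∞`, the value at `z = ∞` being
diagonal. The extension is written in the coordinate `w = 1 / z`. -/
def loopGroupMinus (N : ℕ) : Subgroup (Loop N)ˣ where
  carrier := {g | g ∈ loopGroup N ∧ ∃ E : ℂ → Matrix (Fin N) (Fin N) ℂ, IsGroupDisc E ∧
    (∀ z : Circle, E ((z⁻¹ : Circle) : ℂ) = (g : Loop N) z) ∧ (E 0).IsDiag}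
  one_mem' := ⟨one_mem _, _, IsGroupDisc.one, fun _ => rfl, Matrix.isDiag_one⟩
  mul_mem' := by
    rintro g h ⟨hg, E, hE, hEg, hE0⟩ ⟨hh, E', hE', hEh, hE0'⟩
    refine ⟨mul_mem hg hh, _, hE.mul hE', fun z => ?_, ?_⟩
    · simp only [hEg, hEh, Units.val_mul, ContinuousMap.mul_apply]
    · show (E 0 * E' 0).IsDiag
      rw [← hE0.diagonal_diag, ← hE0'.diagonal_diag, Matrix.diagonal_mul_diagonal]
      exact Matrix.isDiag_diagonal _
  inv_mem' := by
    rintro g ⟨hg, E, hE, hEg, hE0⟩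
    refine ⟨inv_mem hg, _, hE.inverse, fun z => ?_, ?_⟩
    · rw [coe_inv_apply, hEg]
    · show (Ring.inverse (E 0)).IsDiag
      rw [← Matrix.nonsing_inv_eq_ringInverse, ← hE0.diagonal_diag, Matrix.inv_diagonal]
      exact Matrix.isDiag_diagonal _

/-- `Ad_g X = g X g⁻¹`. -/
def Ad (g : (Loop N)ˣ) (X : Loop N) : Loop N :=
  (g : Loop N) * X * ((g⁻¹ : (Loop N)ˣ) : Loop N)

/-- `gp`, `gm` are smooth curves in the two loop subgroups, on the open interval `I` around `0`,
which start at the identity and solve `exp (t G) = gp(t)⁻¹ gm(t)`. -/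
structure IsFactorization (G : Loop N) (I : Set ℝ) (gp gm : ℝ → (Loop N)ˣ) : Prop where
  isOpen : IsOpen I
  ordConnected : I.OrdConnected
  zero_mem : (0 : ℝ) ∈ I
  plus_mem : ∀ t ∈ I, gp t ∈ loopGroupPlus N
  minus_mem : ∀ t ∈ I, gm t ∈ loopGroupMinus N
  plus_smooth : ContDiffOn ℝ ∞ (fun t => (gp t : Loop N)) I
  minus_smooth : ContDiffOn ℝ ∞ (fun t => (gm t : Loop N)) I
  plus_zero : gp 0 = 1
  minus_zero : gm 0 = 1
  factor : ∀ t ∈ I, NormedSpace.exp (t • G) = (((gp t)⁻¹ * gm t : (Loop N)ˣ) : Loop N)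

/-- The factorization on the maximal interval: every other one is a restriction of it. -/
structure IsMaximalFactorization (G : Loop N) (I : Set ℝ) (gp gm : ℝ → (Loop N)ˣ) : Prop
    extends IsFactorization G I gp gm where
  maximal : ∀ (J : Set ℝ) (hp hm : ℝ → (Loop N)ˣ), IsFactorization G J hp hm →
    J ⊆ I ∧ ∀ t ∈ J, hp t = gp t ∧ hm t = gm t

end MarkovLax

end

noncomputable section

open Set Filter Topology Metric

namespace MarkovLax

/-! ### Differential inequalities and linear equations -/

section ODE

variable {E : Type*} [NormedAddCommGroup E] [NormedSpace ℝ E]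

/-! Write `X = z M_u - A`. Differentiating under the trace gives the gradient `G(X) = z φ(X / z)`,
and nondegeneracy of the pairing makes it unique (`isGradientAt_hamiltonian_iff`). With `w = 1 / z`
this is `φ(M_u - w A) / w`, which expands at `z = ∞` as `z M_f + D + O(1 / z)`. Differentiating the
commutation of `M_u - w A` with `φ(M_u - w A)` shows that `D` and `B` agree off the diagonal. Hence
`G(X)` is `z M_f + B`, in the plus algebra, plus an element of the minus algebra
(`gradLoop_sub_fieldLoop_mem`). The two algebras meet only in `0`, by Liouville
(`eq_of_eqOn_circle`), so factorizations are unique, and the union of all of them is maximal.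

Local existence comes from the equation itself. Solve `A' = [A, B]`, `g' = -(z M_f + B) g` in a
Banach space. Then `g` intertwines `X_0` with `X_t`, so `g exp(tG)` solves a linear equation with
coefficient `G(X_t) - (z M_f + B)`. By `sub_one_mem_of_hasDerivAt`, `g` stays in the plus group and
`g exp(tG)` in the minus group for small `t` (`exists_isFactorization`).

Conversely, take any factorization. As `X_0` commutes with `G`, both factors conjugate it to the
same loop, and Liouville forces the form `z M_u - A` (`exists_laxLoop_eq`). Differentiating `g_+
exp(tG) = g_-` and splitting into the two algebras gives `g_+' = -(z M_f + B) g_+`, hence the Lax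
equation. Its `z`-dependence cancels (`lax_bracket`), leaving an ODE for `A` with smooth vector
field, so solutions are unique. -/

lemma eq_zero_of_deriv_bound_right {I : Set ℝ} (hc : I.OrdConnected) (h0 : (0 : ℝ) ∈ I)
    {h h' : ℝ → E} {K : ℝ → ℝ} (hd : ∀ t ∈ I, HasDerivAt h (h' t) t) (hK : ContinuousOn K I)
    (hb : ∀ t ∈ I, ‖h' t‖ ≤ K t * ‖h t‖) (hz : h 0 = 0) {t : ℝ} (ht : t ∈ I) (ht0 : 0 ≤ t) :
    h t = 0 := by
  have hsub : Icc 0 t ⊆ I := hc.out h0 ht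
  obtain ⟨C, hC⟩ := (isCompact_Icc (a := (0 : ℝ)) (b := t)).bddAbove_image (hK.mono hsub)
  refine eq_zero_of_abs_deriv_le_mul_abs_self_of_eq_zero_right (K := C) (f := h) (f' := h')
    (fun x hx => (hd x (hsub hx)).continuousAt.continuousWithinAt)
    (fun x hx => (hd x (hsub (Ico_subset_Icc_self hx))).hasDerivWithinAt) hz
    (fun x hx => ?_) t ⟨ht0, le_rfl⟩
  refine (hb x (hsub (Ico_subset_Icc_self hx))).trans ?_
  have : K x ≤ C := hC (mem_image_of_mem K (Ico_subset_Icc_self hx))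
  gcongr

lemma eq_zero_of_deriv_bound {I : Set ℝ} (hc : I.OrdConnected) (h0 : (0 : ℝ) ∈ I)
    {h h' : ℝ → E} {K : ℝ → ℝ} (hd : ∀ t ∈ I, HasDerivAt h (h' t) t) (hK : ContinuousOn K I)
    (hb : ∀ t ∈ I, ‖h' t‖ ≤ K t * ‖h t‖) (hz : h 0 = 0) {t : ℝ} (ht : t ∈ I) : h t = 0 := by
  rcases le_total 0 t with ht0 | ht0
  · exact eq_zero_of_deriv_bound_right hc h0 hd hK hb hz ht ht0
  -- Negative times reduce to positive ones by reversing time.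
  · have hc' : (Neg.neg ⁻¹' I).OrdConnected := by
      refine ⟨fun x hx y hy s hs => hc.out hy hx ⟨neg_le_neg hs.2, neg_le_neg hs.1⟩⟩
    have key := eq_zero_of_deriv_bound_right (I := Neg.neg ⁻¹' I) (h := fun s => h (-s))
      (h' := fun s => -h' (-s)) (K := fun s => K (-s)) hc' (by simpa using h0)
      (fun s hs => by
        have := (hd (-s) hs).scomp s (hasDerivAt_neg s)
        simpa [Function.comp_def] using this)
      (hK.comp continuous_neg.continuousOn fun s hs => hs)
      (fun s hs => by simpa using hb (-s) hs) (by simpa using hz) (t := -t) (by simpa using ht)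
      (by linarith)
    simpa using key

variable {𝔸 : Type*} [NormedRing 𝔸] [NormedAlgebra ℝ 𝔸]

/-- A linear equation `g' = R g` whose coefficient lies in a closed subspace `V`, stable under
left multiplication by the coefficient, has its solution starting at `1` in `1 + V`. -/
lemma sub_one_mem_of_hasDerivAt (V : Submodule ℝ 𝔸) (hV : IsClosed (V : Set 𝔸)) {I : Set ℝ}
    (hc : I.OrdConnected) (h0 : (0 : ℝ) ∈ I) {g R : ℝ → 𝔸}
    (hd : ∀ t ∈ I, HasDerivAt g (R t * g t) t) (hR : ContinuousOn R I)
    (hRV : ∀ t ∈ I, R t ∈ V) (hmul : ∀ t ∈ I, ∀ v ∈ V, R t * v ∈ V) (hg : g 0 = 1)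
    {t : ℝ} (ht : t ∈ I) : g t - 1 ∈ V := by
  -- Used by instance search: closedness of `V` makes the quotient a normed group.
  have : IsClosed (V : Set 𝔸) := hV
  have key : V.mkQL (g t - 1) = 0 := by
    refine eq_zero_of_deriv_bound (E := 𝔸 ⧸ V) hc h0 (h := fun s => V.mkQL (g s - 1))
      (h' := fun s => V.mkQL (R s * g s)) (K := fun s => ‖R s‖)
      (fun s hs => V.mkQL.hasFDerivAt.comp_hasDerivAt s ((hd s hs).sub_const 1)) hR.norm
      (fun s hs => ?_) (by simp [hg]) ht
    -- Modulo `V`, `R g` depends only on the class of `g - 1`, because `R` and `R v` lie in `V`.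
    -- Choosing `v` almost optimally turns the right side into the quotient norm, and Gronwall
    -- applies.
    have h1 : ∀ v ∈ V, ‖V.mkQL (R s * g s)‖ ≤ ‖R s‖ * ‖g s - 1 + v‖ := by
      intro v hv
      have h2 : V.mkQL (R s * g s) = V.mkQL (R s * (g s - 1 + v)) := by
        rw [← sub_eq_zero, ← map_sub]
        have : R s * g s - R s * (g s - 1 + v) = R s - R s * v := by noncomm_ring
        rw [this]
        exact (Submodule.Quotient.mk_eq_zero V).mpr (V.sub_mem (hRV s hs) (hmul s hs v hv))
      rw [h2]
      exact (Submodule.Quotient.norm_mk_le V _).trans (norm_mul_le _ _)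
    refine le_of_forall_pos_le_add fun ε hε => ?_
    obtain ⟨v, hv, hlt⟩ := Submodule.Quotient.norm_mk_lt (S := V) (V.mkQL (g s - 1))
      (ε := ε / (‖R s‖ + 1)) (by positivity)
    have hmem : v - (g s - 1) ∈ V := by
      rw [← Submodule.Quotient.mk_eq_zero, Submodule.Quotient.mk_sub, hv]
      simp
    have h3 := h1 _ hmem
    rw [add_sub_cancel] at h3
    refine h3.trans ?_
    have h4 : ‖R s‖ * (ε / (‖R s‖ + 1)) ≤ ε := by
      rw [mul_div_assoc', div_le_iff₀ (by positivity)]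
      nlinarith [norm_nonneg (R s)]
    calc ‖R s‖ * ‖v‖ ≤ ‖R s‖ * (‖V.mkQL (g s - 1)‖ + ε / (‖R s‖ + 1)) := by gcongr
      _ ≤ _ := by rw [mul_add]; gcongr
  exact (Submodule.Quotient.mk_eq_zero V).mp key

/-- Integral curves of a smooth vector field are smooth. -/
lemma contDiffOn_of_hasDerivAt {v : E → E} (hv : ContDiff ℝ ∞ v) {I : Set ℝ} (hI : IsOpen I)
    {x : ℝ → E} (hx : ∀ t ∈ I, HasDerivAt x (v (x t)) t) : ContDiffOn ℝ ∞ x I := by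
  rw [contDiffOn_infty]
  intro n
  induction n with
  | zero =>
    exact contDiffOn_zero.mpr fun t ht => (hx t ht).continuousAt.continuousWithinAt
  | succ n ih =>
    have : ((n + 1 : ℕ) : WithTop ℕ∞) = (n : WithTop ℕ∞) + 1 := by push_cast; rfl
    rw [this, contDiffOn_succ_iff_deriv_of_isOpen hI]
    refine ⟨fun t ht => (hx t ht).differentiableAt.differentiableWithinAt, by simp, ?_⟩
    have h1 : ContDiffOn ℝ n (fun t => v (x t)) I :=
      (hv.of_le (by exact_mod_cast le_top)).comp_contDiffOn ih
    exact h1.congr fun t ht => (hx t ht).deriv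

end ODE

/-! ### A Liouville theorem for functions on the two discs -/

section Liouville

variable {F : Type*} [NormedAddCommGroup F] [NormedSpace ℂ F]

/-- On the unit circle `dz = i z dθ`, which absorbs the factor `z⁻¹`. -/
lemma circleIntegral_unit (h : ℂ → F) (c : ℂ → ℂ) :
    (2 * Real.pi * Complex.I : ℂ)⁻¹ • ∮ z in C(0, 1), (z⁻¹ * c z) • h z =
      (2 * Real.pi : ℂ)⁻¹ • ∫ θ in (0 : ℝ)..2 * Real.pi,
        c (Circle.exp θ) • h (Circle.exp θ) := by
  have h1 : ∀ θ : ℝ, deriv (circleMap 0 1) θ • ((circleMap 0 1 θ)⁻¹ * c (circleMap 0 1 θ)) •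
      h (circleMap 0 1 θ) = Complex.I • (c (Circle.exp θ) • h (Circle.exp θ)) := by
    intro θ
    have h2 : circleMap 0 1 θ = Circle.exp θ := by simp [circleMap]
    have h3 : (Circle.exp θ : ℂ) ≠ 0 := Circle.coe_ne_zero _
    rw [deriv_circleMap, h2, smul_smul, smul_smul]
    congr 1
    field_simp
  simp only [circleIntegral, h1]
  rw [intervalIntegral.integral_smul, smul_smul]
  congr 1
  field_simp

variable [CompleteSpace F]

lemma cauchy_exp {P : ℂ → F} (hP : DiffContOnCl ℂ P (ball 0 1)) {a : ℂ} (ha : ‖a‖ < 1) :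
    (2 * Real.pi : ℂ)⁻¹ • ∫ θ in (0 : ℝ)..2 * Real.pi,
      ((Circle.exp θ : ℂ) / ((Circle.exp θ : ℂ) - a)) • P (Circle.exp θ) = P a := by
  have h := hP.two_pi_i_inv_smul_circleIntegral_sub_inv_smul (w := a) (by simpa using ha)
  rw [← h, ← circleIntegral_unit P (fun z => z / (z - a))]
  congr 1
  refine circleIntegral.integral_congr zero_le_one fun z hz => ?_
  have hz0 : z ≠ 0 := by
    rintro rfl
    simp at hz
  congr 1
  field_simp

/-- Inverting the circle turns the Cauchy kernel `z / (z - a)` of `P` into `1 / (1 - a w)`, which is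
holomorphic on the closed disc. The integral for `P a` is then the mean of `(1 - a w)⁻¹ Q(w)`, that
is, its value `Q 0` at `w = 0`. No gluing across the circle is needed. -/
lemma eq_of_eqOn_circle {P Q : ℂ → F} (hP : DiffContOnCl ℂ P (ball 0 1))
    (hQ : DiffContOnCl ℂ Q (ball 0 1)) (h : ∀ z : Circle, P z = Q ((z⁻¹ : Circle) : ℂ)) :
    ∀ z ∈ closedBall (0 : ℂ) 1, P z = Q 0 := by
  have hin : ∀ a : ℂ, ‖a‖ < 1 → P a = Q 0 := by
    intro a ha
    have hne : ∀ z : ℂ, ‖z‖ ≤ 1 → 1 - a * z ≠ 0 := by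
      intro z hz h0
      have : ‖a * z‖ = 1 := by rw [← sub_eq_zero.mp h0]; simp
      rw [norm_mul] at this
      nlinarith [norm_nonneg a, norm_nonneg z]
    have hQ' : DiffContOnCl ℂ (fun w => (1 - a * w)⁻¹ • Q w) (ball 0 1) := by
      refine DiffContOnCl.smul (DiffContOnCl.inv ?_ fun z hz => ?_) hQ
      · exact (Differentiable.diffContOnCl (by fun_prop))
      · rw [closure_ball _ one_ne_zero] at hz
        exact hne z (by simpa using hz)
    have h2 := cauchy_exp hQ' (a := 0) (by simp)
    simp only [mul_zero, sub_zero, inv_one, one_smul] at h2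
    rw [← cauchy_exp hP ha, ← h2]
    congr 1
    set k : ℝ → F := fun θ =>
      ((Circle.exp θ : ℂ) / (Circle.exp θ : ℂ)) • (1 - a * (Circle.exp θ : ℂ))⁻¹ •
        Q (Circle.exp θ) with hk
    have hper : Function.Periodic k (2 * Real.pi) := by
      intro θ
      simp only [hk, Circle.exp_add_two_pi]
    have hrefl : ∀ θ : ℝ, ((Circle.exp θ : ℂ) / ((Circle.exp θ : ℂ) - a)) • P (Circle.exp θ) =
        k (-θ) := by
      intro θ
      have h3 : (Circle.exp θ : ℂ) ≠ 0 := Circle.coe_ne_zero _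
      have h4 : (Circle.exp θ : ℂ) - a ≠ 0 := by
        intro h0
        have : ‖(Circle.exp θ : ℂ)‖ = ‖a‖ := by rw [sub_eq_zero.mp h0]
        simp at this
        linarith
      simp only [hk, Circle.exp_neg, Circle.coe_inv]
      rw [h, Circle.coe_inv, smul_smul]
      congr 1
      field_simp
    simp only [hrefl]
    -- The reflection moves the interval to `[-2π, 0]`; periodicity moves it back.
    rw [intervalIntegral.integral_comp_neg]
    have := hper.intervalIntegral_add_eq (-(2 * Real.pi)) 0
    simpa using this
  have hcl : closure (ball (0 : ℂ) 1) = closedBall 0 1 := closure_ball 0 one_ne_zero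
  intro z hz
  have : EqOn P (fun _ => Q 0) (closure (ball 0 1)) :=
    EqOn.of_subset_closure (fun a ha => hin a (by simpa using ha)) hP.continuousOn
      continuousOn_const subset_closure le_rfl
  exact this (hcl ▸ hz)

end Liouville

variable {N : ℕ}

/-! ### Real loops -/

/-- The loops with real Laurent coefficients, as a real subalgebra. -/
def realLoops (N : ℕ) : Subalgebra ℝ (Loop N) where
  carrier := {X | IsRealLoop X}
  mul_mem' := by
    intro X Y hX hY z
    simp only [ContinuousMap.mul_apply, map_mul, hX z, hY z]
  add_mem' := by
    intro X Y hX hY z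
    simp only [ContinuousMap.add_apply, map_add, hX z, hY z]
  algebraMap_mem' := by
    intro r z
    ext i j
    by_cases hij : i = j <;> simp [Algebra.algebraMap_eq_smul_one, hij]

lemma mem_realLoops {X : Loop N} : X ∈ realLoops N ↔ IsRealLoop X := Iff.rfl

lemma mem_loopGroup {g : (Loop N)ˣ} : g ∈ loopGroup N ↔ (g : Loop N) ∈ realLoops N := Iff.rfl

lemma isClosed_realLoops : IsClosed (realLoops N : Set (Loop N)) := by
  have : (realLoops N : Set (Loop N)) =
      ⋂ z : Circle, {X : Loop N | X z⁻¹ = (starRingEnd ℂ).mapMatrix (X z)} := by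
    ext X
    simp [mem_realLoops, IsRealLoop]
  rw [this]
  refine isClosed_iInter fun z => isClosed_eq (continuous_eval_const _) ?_
  have h : Continuous fun A : Matrix (Fin N) (Fin N) ℂ => (starRingEnd ℂ).mapMatrix A :=
    Continuous.matrix_map continuous_id Complex.continuous_conj
  exact h.comp (continuous_eval_const _)

/-- The loop `z ↦ X(1 / z)`. -/
def flip : Loop N →L[ℝ] Loop N where
  toFun X := X.comp ⟨fun z => z⁻¹, continuous_inv⟩
  map_add' _ _ := rfl
  map_smul' _ _ := rfl
  cont := ContinuousMap.continuous_precomp _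

@[simp] lemma flip_apply (X : Loop N) (z : Circle) : flip X z = X z⁻¹ := rfl

lemma flip_mul (X Y : Loop N) : flip (X * Y) = flip X * flip Y := rfl

lemma norm_flip_le (X : Loop N) : ‖flip X‖ ≤ ‖X‖ :=
  (ContinuousMap.norm_le _ (norm_nonneg _)).mpr fun z => X.norm_coe_le_norm z⁻¹

lemma isRealLoop_flip {X : Loop N} : IsRealLoop (flip X) ↔ IsRealLoop X :=
  ⟨fun h z => by simpa using h z⁻¹, fun h z => h z⁻¹⟩

/-! ### Loops that extend to the disc -/

/-- Real loops that extend holomorphically to the unit disc, with value at `0` in `K`. -/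
def discSubmodule (K : Submodule ℝ (Matrix (Fin N) (Fin N) ℂ)) : Submodule ℝ (Loop N) where
  carrier := {X | IsRealLoop X ∧ ∃ E : ℂ → Matrix (Fin N) (Fin N) ℂ,
    DiffContOnCl ℂ E (ball 0 1) ∧ (∀ z : Circle, E z = X z) ∧ E 0 ∈ K}
  add_mem' := by
    rintro X Y ⟨hX, E, hE, hEX, hE0⟩ ⟨hY, E', hE', hEY, hE0'⟩
    exact ⟨(realLoops N).add_mem hX hY, _, hE.add hE', fun z => by simp [hEX, hEY],
      K.add_mem hE0 hE0'⟩
  zero_mem' := ⟨(realLoops N).zero_mem, _, diffContOnCl_const, fun _ => rfl, K.zero_mem⟩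
  smul_mem' := by
    rintro c X ⟨hX, E, hE, hEX, hE0⟩
    exact ⟨(realLoops N).smul_mem hX c, _, hE.const_smul c, fun z => by simp [hEX],
      K.smul_mem c hE0⟩

lemma discSubmodule_mul_mem {K : Submodule ℝ (Matrix (Fin N) (Fin N) ℂ)}
    (hK : ∀ A ∈ K, ∀ B ∈ K, A * B ∈ K) {X Y : Loop N} (hX : X ∈ discSubmodule K)
    (hY : Y ∈ discSubmodule K) : X * Y ∈ discSubmodule K := by
  obtain ⟨hX, E, hE, hEX, hE0⟩ := hX
  obtain ⟨hY, E', hE', hEY, hE0'⟩ := hY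
  exact ⟨(realLoops N).mul_mem hX hY, fun z => E z * E' z, ⟨hE.1.mul hE'.1, hE.2.mul hE'.2⟩,
    fun z => by simp [hEX, hEY], hK _ hE0 _ hE0'⟩

/-- Maximum principle. -/
lemma norm_le_of_extends {E : ℂ → Matrix (Fin N) (Fin N) ℂ} (hE : DiffContOnCl ℂ E (ball 0 1))
    {X : Loop N} (hEX : ∀ z : Circle, E z = X z) {z : ℂ} (hz : z ∈ closedBall (0 : ℂ) 1) :
    ‖E z‖ ≤ ‖X‖ := by
  have hcl : closure (ball (0 : ℂ) 1) = closedBall 0 1 := closure_ball 0 one_ne_zero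
  refine Complex.norm_le_of_forall_mem_frontier_norm_le isBounded_ball hE (fun w hw => ?_)
    (hcl.symm ▸ hz)
  rw [frontier_ball _ one_ne_zero] at hw
  have h1 := hEX ⟨w, hw⟩
  rw [show E w = X ⟨w, hw⟩ from h1]
  exact X.norm_coe_le_norm _

/-- By the maximum principle, uniform convergence on the circle makes the extensions uniformly
Cauchy on the closed disc, and uniform limits stay holomorphic inside. Closedness is what lets ODE
solutions and difference quotients remain in the two algebras. -/
lemma isClosed_discSubmodule {K : Submodule ℝ (Matrix (Fin N) (Fin N) ℂ)}
    (hK : IsClosed (K : Set (Matrix (Fin N) (Fin N) ℂ))) :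
    IsClosed (discSubmodule K : Set (Loop N)) := by
  have hcl : closure (ball (0 : ℂ) 1) = closedBall 0 1 := closure_ball 0 one_ne_zero
  refine IsSeqClosed.isClosed fun x X hx hlim => ?_
  refine ⟨isClosed_realLoops.isSeqClosed (fun n => (hx n).1) hlim, ?_⟩
  choose hreal E hE hEX hE0 using hx
  have hcauchy : UniformCauchySeqOn E atTop (closedBall 0 1) := by
    rw [Metric.uniformCauchySeqOn_iff]
    intro ε hε
    obtain ⟨n₀, h₀⟩ := Metric.cauchySeq_iff.mp hlim.cauchySeq ε hε
    refine ⟨n₀, fun m hm n hn z hz => ?_⟩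
    rw [dist_eq_norm]
    refine (norm_le_of_extends ((hE m).sub (hE n)) (X := x m - x n)
      (fun w => by simp [hEX]) hz).trans_lt ?_
    rw [← dist_eq_norm]
    exact h₀ m hm n hn
  have hlim' : ∀ z ∈ closedBall (0 : ℂ) 1, ∃ L, Tendsto (fun n => E n z) atTop (𝓝 L) :=
    fun z hz => cauchySeq_tendsto_of_complete (hcauchy.cauchySeq hz)
  choose! L hL using hlim'
  have hunif := hcauchy.tendstoUniformlyOn_of_tendsto hL
  refine ⟨L, ⟨?_, ?_⟩, fun z => ?_, ?_⟩
  · refine (hunif.mono ball_subset_closedBall).tendstoLocallyUniformlyOn.differentiableOn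
      (Eventually.of_forall fun n => (hE n).1) isOpen_ball
  · rw [hcl]
    exact hunif.continuousOn (Frequently.of_forall fun n => hcl ▸ (hE n).2)
  · refine tendsto_nhds_unique (hL z (by simp [Circle.norm_coe])) ?_
    simp only [hEX]
    exact ((continuous_eval_const z).tendsto X).comp hlim
  · exact hK.mem_of_tendsto (hL 0 (by simp)) (Eventually.of_forall hE0)

/-! ### The two subalgebras -/

/-- Complex matrices with zero row sums. -/
def zeroRowSums (N : ℕ) : Submodule ℝ (Matrix (Fin N) (Fin N) ℂ) where
  carrier := {A | A *ᵥ 1 = 0}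
  add_mem' := by
    intro A B hA hB
    simp only [mem_ofPred_eq] at *
    rw [Matrix.add_mulVec, hA, hB, add_zero]
  zero_mem' := by simp
  smul_mem' := by
    intro c A hA
    simp only [mem_ofPred_eq] at *
    rw [Matrix.smul_mulVec, hA, smul_zero]

/-- Diagonal complex matrices. -/
def diagMatrices (N : ℕ) : Submodule ℝ (Matrix (Fin N) (Fin N) ℂ) where
  carrier := {A | A.IsDiag}
  add_mem' h h' := h.add h'
  zero_mem' := Matrix.isDiag_zero
  smul_mem' c _ h := h.smul c

lemma mem_zeroRowSums {A : Matrix (Fin N) (Fin N) ℂ} : A ∈ zeroRowSums N ↔ A *ᵥ 1 = 0 := Iff.rfl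

lemma mem_diagMatrices {A : Matrix (Fin N) (Fin N) ℂ} : A ∈ diagMatrices N ↔ A.IsDiag := Iff.rfl

lemma isClosed_zeroRowSums : IsClosed (zeroRowSums N : Set (Matrix (Fin N) (Fin N) ℂ)) := by
  have h : Continuous fun A : Matrix (Fin N) (Fin N) ℂ => A *ᵥ (1 : Fin N → ℂ) :=
    Continuous.matrix_mulVec continuous_id continuous_const
  exact isClosed_eq h continuous_const

lemma isClosed_diagMatrices : IsClosed (diagMatrices N : Set (Matrix (Fin N) (Fin N) ℂ)) := by
  have : (diagMatrices N : Set (Matrix (Fin N) (Fin N) ℂ)) =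
      ⋂ i, ⋂ j, {A : Matrix (Fin N) (Fin N) ℂ | i ≠ j → A i j = 0} := by
    ext A
    simp [mem_diagMatrices, Matrix.IsDiag, Pairwise]
  rw [this]
  refine isClosed_iInter fun i => isClosed_iInter fun j => ?_
  by_cases hij : i = j
  · simp [hij]
  · simpa [hij] using isClosed_eq (Continuous.matrix_elem continuous_id i j) continuous_const

lemma isDiag_mul {A B : Matrix (Fin N) (Fin N) ℂ} (hA : A.IsDiag) (hB : B.IsDiag) :
    (A * B).IsDiag := by
  rw [← hA.diagonal_diag, ← hB.diagonal_diag, Matrix.diagonal_mul_diagonal]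
  exact Matrix.isDiag_diagonal _

/-- The Lie algebra of `loopGroupPlus`. -/
def algPlus (N : ℕ) : Submodule ℝ (Loop N) := discSubmodule (zeroRowSums N)

/-- The Lie algebra of `loopGroupMinus`. -/
def algMinus (N : ℕ) : Submodule ℝ (Loop N) :=
  (discSubmodule (diagMatrices N)).comap (flip : Loop N →L[ℝ] Loop N).toLinearMap

lemma mem_algMinus {X : Loop N} : X ∈ algMinus N ↔ flip X ∈ discSubmodule (diagMatrices N) :=
  Iff.rfl

lemma isClosed_algPlus : IsClosed (algPlus N : Set (Loop N)) :=
  isClosed_discSubmodule isClosed_zeroRowSums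

lemma isClosed_algMinus : IsClosed (algMinus N : Set (Loop N)) :=
  (isClosed_discSubmodule isClosed_diagMatrices).preimage (flip (N := N)).continuous

lemma algPlus_mul_mem {X Y : Loop N} (hX : X ∈ algPlus N) (hY : Y ∈ algPlus N) :
    X * Y ∈ algPlus N :=
  discSubmodule_mul_mem (fun A _ B hB => by
    rw [mem_zeroRowSums] at hB ⊢
    rw [← Matrix.mulVec_mulVec, hB, Matrix.mulVec_zero]) hX hY

lemma algMinus_mul_mem {X Y : Loop N} (hX : X ∈ algMinus N) (hY : Y ∈ algMinus N) :
    X * Y ∈ algMinus N := by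
  rw [mem_algMinus, flip_mul]
  exact discSubmodule_mul_mem (fun A hA B hB => isDiag_mul hA hB) hX hY

lemma one_mem_algMinus : (1 : Loop N) ∈ algMinus N :=
  ⟨(realLoops N).one_mem, _, diffContOnCl_const, fun _ => rfl, Matrix.isDiag_one⟩

/-- A loop in both subalgebras vanishes. -/
lemma eq_zero_of_mem_algPlus_of_mem_algMinus {X : Loop N} (hp : X ∈ algPlus N)
    (hm : X ∈ algMinus N) : X = 0 := by
  obtain ⟨-, E, hE, hEX, hE0⟩ := hp
  obtain ⟨-, E', hE', hEX', hE0'⟩ := hm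
  have h := eq_of_eqOn_circle hE hE' fun z => by
    rw [hEX, hEX']
    exact congrArg X (inv_inv z).symm
  have h0 := h 0 (by simp)
  have hz : E' 0 = 0 := by
    rw [mem_diagMatrices] at hE0'
    rw [h0, mem_zeroRowSums] at hE0
    rw [← hE0'.diagonal_diag] at hE0 ⊢
    have : ∀ i, E' 0 i i = 0 := fun i => by
      simpa [Matrix.mulVec_diagonal] using congrFun hE0 i
    ext i j
    simp [Matrix.diagonal_apply, this]
  ext1 z
  rw [← hEX, h z (by simp [Circle.norm_coe]), hz]
  rfl

lemma sub_one_mem_algPlus {g : (Loop N)ˣ} (hg : g ∈ loopGroupPlus N) :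
    (g : Loop N) - 1 ∈ algPlus N := by
  obtain ⟨hr, E, hE, hEg, hE0⟩ := hg
  refine ⟨(realLoops N).sub_mem hr (realLoops N).one_mem, fun z => E z - 1,
    hE.1.sub diffContOnCl_const, fun z => by simp [hEg], ?_⟩
  rw [mem_zeroRowSums, Matrix.sub_mulVec, hE0, Matrix.one_mulVec, sub_self]

lemma mem_algMinus_of_mem {g : (Loop N)ˣ} (hg : g ∈ loopGroupMinus N) :
    (g : Loop N) ∈ algMinus N := by
  obtain ⟨hr, E, hE, hEg, hE0⟩ := hg
  exact ⟨isRealLoop_flip.mpr hr, E, hE.1, fun z => by simpa using hEg z⁻¹, hE0⟩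

/-- The bound on the circle propagates to the disc, where the Neumann series inverts `1 + E`. Close
to the identity, invertibility of the extension is therefore automatic. -/
lemma isGroupDisc_one_add {E : ℂ → Matrix (Fin N) (Fin N) ℂ} (hE : DiffContOnCl ℂ E (ball 0 1))
    {X : Loop N} (hEX : ∀ z : Circle, E z = X z) (hX : ‖X‖ < 1) :
    IsGroupDisc (fun z => 1 + E z) := by
  refine ⟨diffContOnCl_const.add hE, fun z hz => ?_⟩
  have h := isUnit_one_sub_of_norm_lt_one (x := -E z)
    (by rw [norm_neg]; exact (norm_le_of_extends hE hEX hz).trans_lt hX)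
  rwa [sub_neg_eq_add] at h

lemma mem_loopGroupPlus_of_norm_lt {g : (Loop N)ˣ} (hg : (g : Loop N) - 1 ∈ algPlus N)
    (hn : ‖(g : Loop N) - 1‖ < 1) : g ∈ loopGroupPlus N := by
  obtain ⟨hr, E, hE, hEg, hE0⟩ := hg
  refine ⟨?_, _, isGroupDisc_one_add hE hEg hn, fun z => by simp [hEg], ?_⟩
  · rw [mem_loopGroup]
    simpa using (realLoops N).add_mem hr (realLoops N).one_mem
  · rw [Matrix.add_mulVec, mem_zeroRowSums.mp hE0, Matrix.one_mulVec, add_zero]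

lemma mem_loopGroupMinus_of_norm_lt {g : (Loop N)ˣ} (hg : (g : Loop N) - 1 ∈ algMinus N)
    (hn : ‖(g : Loop N) - 1‖ < 1) : g ∈ loopGroupMinus N := by
  obtain ⟨hr, E, hE, hEg, hE0⟩ := hg
  refine ⟨?_, _, isGroupDisc_one_add hE hEg ((norm_flip_le _).trans_lt hn), fun z => ?_, ?_⟩
  · rw [mem_loopGroup]
    simpa using (realLoops N).add_mem (isRealLoop_flip.mp hr) (realLoops N).one_mem
  · rw [hEg]
    simp
  · exact Matrix.isDiag_one.add hE0

/-- The factorization of a loop is unique. -/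
lemma eq_of_inv_mul_eq {gp gm hp hm : (Loop N)ˣ} (hgp : gp ∈ loopGroupPlus N)
    (hgm : gm ∈ loopGroupMinus N) (hhp : hp ∈ loopGroupPlus N) (hhm : hm ∈ loopGroupMinus N)
    (h : hp⁻¹ * hm = gp⁻¹ * gm) : hp = gp ∧ hm = gm := by
  -- This common element lies in both groups, so subtracting `1` puts it in both algebras.
  have hk : gp * hp⁻¹ = gm * hm⁻¹ := by
    rw [← mul_right_inj gp⁻¹, ← mul_left_inj hm]
    simpa [mul_assoc] using h
  have h1 := sub_one_mem_algPlus (mul_mem hgp (inv_mem hhp))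
  have h2 := mem_algMinus_of_mem (mul_mem hgm (inv_mem hhm))
  rw [← hk] at h2
  have h3 := eq_zero_of_mem_algPlus_of_mem_algMinus h1
    ((algMinus N).sub_mem h2 one_mem_algMinus)
  have h4 : gp * hp⁻¹ = 1 := Units.ext (sub_eq_zero.mp h3)
  have h5 : hp = gp := (mul_inv_eq_one.mp h4).symm
  refine ⟨h5, ?_⟩
  rw [h4] at hk
  exact (mul_inv_eq_one.mp hk.symm).symm

/-! ### Entire functions on Banach algebras -/

section Entire

/-- The factor `‖1‖ + 1` covers `n = 0` without assuming `‖1‖ = 1`. -/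
lemma norm_pow_le_mul {𝔸 : Type*} [NormedRing 𝔸] (X : 𝔸) {r : ℝ} (hX : ‖X‖ ≤ r) (n : ℕ) :
    ‖X ^ n‖ ≤ (‖(1 : 𝔸)‖ + 1) * r ^ n := by
  have hr : 0 ≤ r := (norm_nonneg X).trans hX
  rcases Nat.eq_zero_or_pos n with rfl | hn
  · simp
  · calc ‖X ^ n‖ ≤ ‖X‖ ^ n := norm_pow_le' X hn
      _ ≤ r ^ n := by gcongr
      _ = 1 * r ^ n := (one_mul _).symm
      _ ≤ (‖(1 : 𝔸)‖ + 1) * r ^ n := by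
        gcongr
        linarith [norm_nonneg (1 : 𝔸)]

variable {𝔸 𝔹 : Type*} [NormedRing 𝔸] [NormedAlgebra ℝ 𝔸] [NormedRing 𝔹] [NormedAlgebra ℝ 𝔹]

/-- The value at `X` of the entire function with Taylor coefficients `a`. -/
def entireSum (a : ℕ → ℝ) (X : 𝔸) : 𝔸 := ∑' n, a n • X ^ n

lemma summable_abs_mul_pow {a : ℕ → ℝ} (ha : ∀ r : ℝ, Summable fun n => a n * r ^ n) {r : ℝ}
    (hr : 0 ≤ r) : Summable fun n => |a n| * r ^ n := by
  refine (ha r).abs.congr fun n => ?_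
  rw [abs_mul, abs_of_nonneg (pow_nonneg hr n)]

lemma norm_smul_pow_le (a : ℕ → ℝ) (X : 𝔸) {r : ℝ} (hX : ‖X‖ ≤ r) (n : ℕ) :
    ‖a n • X ^ n‖ ≤ (‖(1 : 𝔸)‖ + 1) * (|a n| * r ^ n) := by
  rw [norm_smul, Real.norm_eq_abs]
  calc |a n| * ‖X ^ n‖ ≤ |a n| * ((‖(1 : 𝔸)‖ + 1) * r ^ n) := by
        gcongr
        exact norm_pow_le_mul X hX n
    _ = _ := by ring

variable {a : ℕ → ℝ} (ha : ∀ r : ℝ, Summable fun n => a n * r ^ n)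
include ha

lemma summable_smul_pow [CompleteSpace 𝔸] (X : 𝔸) : Summable fun n => a n • X ^ n :=
  Summable.of_norm_bounded ((summable_abs_mul_pow ha (norm_nonneg X)).mul_left _)
    (norm_smul_pow_le a X le_rfl)

lemma map_entireSum [CompleteSpace 𝔸] (ψ : 𝔸 →ₐ[ℝ] 𝔹) (hψ : Continuous ψ) (X : 𝔸) :
    ψ (entireSum a X) = entireSum a (ψ X) := by
  rw [entireSum, Summable.map_tsum (summable_smul_pow ha X) ψ hψ]
  simp [entireSum]

lemma entireSum_conj [CompleteSpace 𝔸] (g : 𝔸ˣ) (X : 𝔸) :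
    entireSum a (g * X * (g⁻¹ : 𝔸ˣ)) = g * entireSum a X * (g⁻¹ : 𝔸ˣ) := by
  have h := summable_smul_pow ha X
  rw [entireSum, entireSum, ← h.tsum_mul_left, ← (h.mul_left _).tsum_mul_right]
  simp [Units.conj_pow]

end Entire

lemma commute_entireSum {𝔸 : Type*} [NormedRing 𝔸] [NormedAlgebra ℝ 𝔸] (a : ℕ → ℝ) (X : 𝔸) :
    Commute X (entireSum a X) :=
  Commute.tsum_right X fun n => ((Commute.refl X).pow_right n).smul_right (a n)

lemma entireEval_eq (a : ℕ → ℝ) (X : Loop N) : entireEval a X = entireSum a X := rfl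

section

variable {a : ℕ → ℝ} (ha : ∀ r : ℝ, Summable fun n => a n * r ^ n)
include ha

lemma entireSum_apply (X : Loop N) (z : Circle) : entireSum a X z = entireSum a (X z) :=
  map_entireSum ha
    ({ toFun := fun X => X z
       map_one' := rfl
       map_mul' := fun _ _ => rfl
       map_zero' := rfl
       map_add' := fun _ _ => rfl
       commutes' := fun _ => rfl } : Loop N →ₐ[ℝ] Matrix (Fin N) (Fin N) ℂ)
    (continuous_eval_const z) X

lemma isRealLoop_entireSum {X : Loop N} (hX : IsRealLoop X) : IsRealLoop (entireSum a X) := by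
  refine isClosed_realLoops.mem_of_tendsto (summable_smul_pow ha X).hasSum.tendsto_sum_nat
    (Eventually.of_forall fun n => ?_)
  exact (realLoops N).sum_mem fun i _ =>
    (realLoops N).smul_mem ((realLoops N).pow_mem hX i) (a i)

/-- Weierstrass test on balls. In the coordinate `w = 1 / z` the loop `X / z` has the form `C - w
D`, so this controls the gradient near `z = ∞`. -/
lemma differentiable_entireSum (C D : Matrix (Fin N) (Fin N) ℂ) :
    Differentiable ℂ fun w : ℂ => entireSum a (C - w • D) := by
  intro w₀
  have hd : DifferentiableOn ℂ (fun w : ℂ => entireSum a (C - w • D)) (ball 0 (‖w₀‖ + 1)) := by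
    refine Complex.differentiableOn_tsum_of_summable_norm (F := fun n w => a n • (C - w • D) ^ n)
      ((summable_abs_mul_pow ha (r := ‖C‖ + (‖w₀‖ + 1) * ‖D‖) (by positivity)).mul_left
        (‖(1 : Matrix (Fin N) (Fin N) ℂ)‖ + 1))
      (fun n => ?_) isOpen_ball fun n w hw => norm_smul_pow_le a _ ?_ n
    · exact Differentiable.differentiableOn (by fun_prop)
    · have hw' : ‖w‖ ≤ ‖w₀‖ + 1 := by simpa using (mem_ball_zero_iff.mp hw).le
      calc ‖C - w • D‖ ≤ ‖C‖ + ‖w • D‖ := norm_sub_le _ _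
        _ ≤ _ := by rw [norm_smul]; gcongr
  exact hd.differentiableAt (isOpen_ball.mem_nhds (by simp))

end

/-! ### The loops attached to the Lax equation -/

/-- The loop `z M_f + B(A)`. -/
def fieldLoop (u : Fin N → ℝ) (f : ℝ → ℝ) (A : Matrix (Fin N) (Fin N) ℝ) : Loop N where
  toFun z := (z : ℂ) • Mu (f ∘ u) + toComplex (companion u f A)
  continuous_toFun := by fun_prop

/-- The loop `z φ(X / z)`, where `φ` has Taylor coefficients `a`. -/
def gradLoop (a : ℕ → ℝ) (X : Loop N) : Loop N :=
  zpowLoop N 1 * entireSum a (X * zpowLoop N (-1))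

lemma zpowLoop_apply (k : ℤ) (z : Circle) :
    zpowLoop N k z = ((z ^ k : Circle) : ℂ) • (1 : Matrix (Fin N) (Fin N) ℂ) := rfl

lemma laxLoop_apply (u : Fin N → ℝ) (A : Matrix (Fin N) (Fin N) ℝ) (z : Circle) :
    laxLoop u A z = (z : ℂ) • Mu u - toComplex A := rfl

lemma fieldLoop_apply (u : Fin N → ℝ) (f : ℝ → ℝ) (A : Matrix (Fin N) (Fin N) ℝ) (z : Circle) :
    fieldLoop u f A z = (z : ℂ) • Mu (f ∘ u) + toComplex (companion u f A) := rfl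

lemma commute_zpowLoop (k : ℤ) (X : Loop N) : Commute (zpowLoop N k) X := by
  ext1 z
  simp [zpowLoop_apply]

lemma zpowLoop_mul (k l : ℤ) : zpowLoop N k * zpowLoop N l = zpowLoop N (k + l) := by
  ext1 z
  simp [zpowLoop_apply, smul_smul, zpow_add, mul_comm]

lemma zpowLoop_zero : zpowLoop N 0 = 1 := by
  ext1 z
  simp [zpowLoop_apply]

lemma map_conj_toComplex (A : Matrix (Fin N) (Fin N) ℝ) :
    (starRingEnd ℂ).mapMatrix (toComplex A) = toComplex A := by
  ext i j
  simp [toComplex]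

lemma map_conj_smul (z : Circle) (A : Matrix (Fin N) (Fin N) ℂ) :
    (starRingEnd ℂ).mapMatrix ((z : ℂ) • A) =
      ((z⁻¹ : Circle) : ℂ) • (starRingEnd ℂ).mapMatrix A := by
  ext i j
  rw [Circle.coe_inv_eq_conj]
  simp

lemma Mu_eq_toComplex (u : Fin N → ℝ) : Mu u = toComplex (Matrix.diagonal u) := by
  ext i j
  by_cases h : i = j <;> simp [Mu, toComplex, h]

lemma isRealLoop_zpowLoop (k : ℤ) : IsRealLoop (zpowLoop N k) := by
  intro z
  rw [zpowLoop_apply, zpowLoop_apply, map_conj_smul, map_one, inv_zpow]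

lemma isRealLoop_laxLoop (u : Fin N → ℝ) (A : Matrix (Fin N) (Fin N) ℝ) :
    IsRealLoop (laxLoop u A) := by
  intro z
  rw [laxLoop_apply, laxLoop_apply, map_sub, map_conj_smul, map_conj_toComplex, Mu_eq_toComplex,
    map_conj_toComplex]

lemma isRealLoop_fieldLoop (u : Fin N → ℝ) (f : ℝ → ℝ) (A : Matrix (Fin N) (Fin N) ℝ) :
    IsRealLoop (fieldLoop u f A) := by
  intro z
  rw [fieldLoop_apply, fieldLoop_apply, map_add, map_conj_smul, map_conj_toComplex,
    Mu_eq_toComplex, map_conj_toComplex]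

lemma companion_row_sum (u : Fin N → ℝ) (f : ℝ → ℝ) (A : Matrix (Fin N) (Fin N) ℝ) (i : Fin N) :
    ∑ j, companion u f A i j = 0 := by
  rw [← Finset.add_sum_erase _ _ (Finset.mem_univ i)]
  have h : ∑ j ∈ Finset.univ.erase i, companion u f A i j =
      ∑ j ∈ Finset.univ.erase i, speedMatrix u f i j * A i j := by
    refine Finset.sum_congr rfl fun j hj => ?_
    simp [companion, (Finset.ne_of_mem_erase hj).symm]
  rw [h]
  simp [companion]

lemma toComplex_mulVec_one {A : Matrix (Fin N) (Fin N) ℝ} :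
    toComplex A *ᵥ 1 = 0 ↔ A ∈ markovAlgebra N := by
  have h : A ∈ markovAlgebra N ↔ ∀ i, ∑ j, A i j = 0 := Iff.rfl
  rw [h, funext_iff]
  refine forall_congr' fun i => ?_
  simp only [Matrix.mulVec, dotProduct, toComplex, Matrix.map_apply, Pi.one_apply, mul_one,
    Pi.zero_apply]
  exact_mod_cast Iff.rfl

lemma fieldLoop_mem_algPlus (u : Fin N → ℝ) (f : ℝ → ℝ) (A : Matrix (Fin N) (Fin N) ℝ) :
    fieldLoop u f A ∈ algPlus N := by
  refine ⟨isRealLoop_fieldLoop u f A,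
    fun z => z • Mu (f ∘ u) + toComplex (companion u f A), ?_, fun z => rfl, ?_⟩
  · exact Differentiable.diffContOnCl (by fun_prop)
  · simp only [zero_smul, zero_add, mem_zeroRowSums]
    exact toComplex_mulVec_one.mpr (companion_row_sum u f A)

lemma companion_apply_of_ne (u : Fin N → ℝ) (f : ℝ → ℝ) (A : Matrix (Fin N) (Fin N) ℝ)
    {i j : Fin N} (hij : i ≠ j) :
    companion u f A i j = -((f (u i) - f (u j)) / (u i - u j)) * A i j := by
  simp [companion, speedMatrix, hij]

lemma entireSum_Mu {u : Fin N → ℝ} {f : ℝ → ℝ} {a : ℕ → ℝ}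
    (haf : ∀ i, HasSum (fun n => a n * u i ^ n) (f (u i))) :
    entireSum a (Mu u) = Mu (f ∘ u) := by
  have h1 : HasSum (fun n i => ((a n * u i ^ n : ℝ) : ℂ)) (fun i => (f (u i) : ℂ)) :=
    Pi.hasSum.mpr fun i => Complex.hasSum_ofReal.mpr (haf i)
  have h2 := h1.matrix_diagonal
  have h3 : Mu (f ∘ u) = Matrix.diagonal fun i => (f (u i) : ℂ) := rfl
  rw [entireSum, h3, ← h2.tsum_eq]
  refine tsum_congr fun n => ?_
  rw [Mu, Matrix.diagonal_pow, ← Matrix.diagonal_smul]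
  congr 1
  ext i
  simp

section

variable {a : ℕ → ℝ} (ha : ∀ r : ℝ, Summable fun n => a n * r ^ n)
include ha

/-- Off the diagonal, the linear coefficient of `φ(M_u - w A)` is the companion matrix. -/
lemma deriv_entireSum_apply {u : Fin N → ℝ} (hu : Function.Injective u) {f : ℝ → ℝ}
    (haf : ∀ i, HasSum (fun n => a n * u i ^ n) (f (u i))) (A : Matrix (Fin N) (Fin N) ℝ)
    {i j : Fin N} (hij : i ≠ j) :
    deriv (fun w : ℂ => entireSum a (Mu u - w • toComplex A)) 0 i j =
      toComplex (companion u f A) i j := by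
  have hΦ := (differentiable_entireSum ha (Mu u) (toComplex A) 0).hasDerivAt
  set D := deriv (fun w : ℂ => entireSum a (Mu u - w • toComplex A)) 0
  have hP : HasDerivAt (fun w : ℂ => Mu u - w • toComplex A) (-toComplex A) 0 := by
    simpa using ((hasDerivAt_id (0 : ℂ)).smul_const (toComplex A)).const_sub (Mu u)
  -- The product rule on both sides of the commutation relation gives `[M_u, D] = [A, M_f]`, whose
  -- `(i, j)` entry is `(u_i - u_j) D_ij = (f(u_j) - f(u_i)) A_ij`.
  have h1 := hP.mul hΦ
  have h2 := hΦ.mul hP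
  have h3 := h1.unique (h2.congr_of_eventuallyEq
    (Eventually.of_forall fun w => (commute_entireSum a _).eq))
  simp only [zero_smul, sub_zero, entireSum_Mu haf] at h3
  have h4 := congrFun (congrFun h3 i) j
  have hne : (u i : ℂ) - u j ≠ 0 := by
    rw [sub_ne_zero]
    exact_mod_cast fun h => hij (hu h)
  simp only [Mu, Matrix.add_apply, Matrix.mul_diagonal, Matrix.diagonal_mul, Matrix.neg_apply,
    neg_mul, Matrix.mul_neg, toComplex, Matrix.map_apply, Function.comp_apply] at h4
  simp only [toComplex, Matrix.map_apply, companion_apply_of_ne u f A hij]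
  push_cast
  field_simp
  linear_combination h4

/-- The gradient splits as `z M_f + B` plus a loop in the negative subalgebra. -/
lemma gradLoop_sub_fieldLoop_mem {u : Fin N → ℝ} (hu : Function.Injective u) {f : ℝ → ℝ}
    (haf : ∀ i, HasSum (fun n => a n * u i ^ n) (f (u i))) (A : Matrix (Fin N) (Fin N) ℝ) :
    gradLoop a (laxLoop u A) - fieldLoop u f A ∈ algMinus N := by
  set Φ : ℂ → Matrix (Fin N) (Fin N) ℂ := fun w => entireSum a (Mu u - w • toComplex A) with hΦ
  -- The gradient is `Φ(w) / w`; subtracting its pole `Φ(0) / w = z M_f` leaves the difference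
  -- quotient of `Φ`, entire by removal of the singularity.
  have hd : Differentiable ℂ (dslope Φ 0) := by
    rw [← differentiableOn_univ, Complex.differentiableOn_dslope univ_mem, differentiableOn_univ]
    exact differentiable_entireSum ha _ _
  refine ⟨isRealLoop_flip.mpr ?_, fun w => dslope Φ 0 w - toComplex (companion u f A),
    (hd.sub_const _).diffContOnCl, fun z => ?_, ?_⟩
  · exact (realLoops N).sub_mem ((realLoops N).mul_mem (isRealLoop_zpowLoop 1)
      (isRealLoop_entireSum ha ((realLoops N).mul_mem (isRealLoop_laxLoop u A)
        (isRealLoop_zpowLoop (-1))))) (isRealLoop_fieldLoop u f A)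
  · have hz : (z : ℂ) ≠ 0 := Circle.coe_ne_zero z
    show dslope Φ 0 (z : ℂ) - toComplex (companion u f A) =
      (gradLoop a (laxLoop u A) - fieldLoop u f A) z⁻¹
    rw [dslope_of_ne _ hz, slope_def_module, ContinuousMap.sub_apply, gradLoop,
      ContinuousMap.mul_apply, entireSum_apply ha, ContinuousMap.mul_apply, zpowLoop_apply,
      zpowLoop_apply, laxLoop_apply, fieldLoop_apply]
    simp only [hΦ, zero_smul, sub_zero, entireSum_Mu haf, zpow_one, zpow_neg, inv_inv,
      Matrix.mul_smul, mul_one, Matrix.smul_mul, one_mul, Circle.coe_inv, smul_sub, smul_smul,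
      mul_inv_cancel₀ hz, one_smul]
    abel
  · intro i j hij
    simp [dslope_same, hΦ, deriv_entireSum_apply ha hu haf A hij]

end

/-! ### The gradient of the Hamiltonian -/

/-- The pairing with a fixed loop. -/
def pairingRight (Y : Loop N) : Loop N →L[ℝ] ℂ where
  toFun X := pairing X Y
  map_add' X X' := by
    have hc : ∀ Z : Loop N, IntervalIntegrable
        (fun θ : ℝ => (Z (Circle.exp θ) * Y (Circle.exp θ)).trace) MeasureTheory.volume 0
        (2 * Real.pi) := fun Z => Continuous.intervalIntegrable (by fun_prop) _ _
    simp only [pairing, ContinuousMap.add_apply, add_mul, Matrix.trace_add]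
    rw [intervalIntegral.integral_add (hc X) (hc X'), mul_add]
  map_smul' c X := by
    simp only [pairing, ContinuousMap.smul_apply, Matrix.smul_mul, Matrix.trace_smul,
      intervalIntegral.integral_smul, RingHom.id_apply, mul_smul_comm]
  cont := by
    refine continuous_const.mul
      (intervalIntegral.continuous_parametric_intervalIntegral_of_continuous' ?_ _ _)
    simp only [Function.uncurry_def]
    fun_prop

lemma pairingRight_apply (X Y : Loop N) : pairingRight Y X = pairing X Y := rfl

lemma pairing_mul_comm {Z : Loop N} (hZ : ∀ X, Commute Z X) (X Y : Loop N) :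
    pairing (X * Y) Z = pairing (Y * X) Z := by
  have h : ∀ z : Circle, Z z * X z = X z * Z z := fun z =>
    congrArg (fun W : Loop N => W z) (hZ X).eq
  simp only [pairing, ContinuousMap.mul_apply]
  congr 1
  refine intervalIntegral.integral_congr fun θ _ => ?_
  rw [mul_assoc, Matrix.trace_mul_comm, mul_assoc, h, ← mul_assoc]

lemma pairing_mul_assoc (X Y Z : Loop N) : pairing (X * Y) Z = pairing X (Y * Z) := by
  simp only [pairing, ContinuousMap.mul_apply, mul_assoc]

/-- Real loops that are orthogonal to all real loops vanish. -/
lemma eq_zero_of_pairing_eq_zero {D : Loop N} (hD : IsRealLoop D)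
    (h : ∀ Y : Loop N, IsRealLoop Y → pairing D Y = 0) : D = 0 := by
  -- Testing against the pointwise adjoint turns the pairing into the mean of the squared moduli of
  -- the entries.
  let Y : Loop N := ⟨fun z => (D z)ᴴ, Continuous.matrix_conjTranspose D.continuous⟩
  have hY : IsRealLoop Y := by
    intro z
    show (D z⁻¹)ᴴ = (starRingEnd ℂ).mapMatrix (D z)ᴴ
    rw [hD z]
    ext i j
    simp
  have h1 := h Y hY
  set k : ℝ → ℝ := fun θ => ∑ i, ∑ j, ‖D (Circle.exp θ) i j‖ ^ 2 with hk
  have hkc : Continuous k := by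
    have hc : ∀ i j, Continuous fun θ : ℝ => D (Circle.exp θ) i j := fun i j =>
      Continuous.matrix_elem (D.continuous.comp Circle.exp.continuous) i j
    exact continuous_finsetSum _ fun i _ => continuous_finsetSum _ fun j _ =>
      ((hc i j).norm.pow 2)
  have hk0 : ∀ θ, 0 ≤ k θ := fun θ => by positivity
  have htr : ∀ θ : ℝ, (D (Circle.exp θ) * Y (Circle.exp θ)).trace = (k θ : ℂ) := by
    intro θ
    show (D (Circle.exp θ) * (D (Circle.exp θ))ᴴ).trace = _
    simp [Matrix.trace, Matrix.mul_apply, hk, Complex.mul_conj']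
  have h2 : ∫ θ in (0 : ℝ)..2 * Real.pi, k θ = 0 := by
    have hpi : (2 * (Real.pi : ℂ))⁻¹ ≠ 0 := by simp [Real.pi_ne_zero]
    simp only [pairing, htr, intervalIntegral.integral_ofReal] at h1
    exact_mod_cast (mul_eq_zero.mp h1).resolve_left hpi
  have hk00 : ∀ θ ∈ Icc 0 (2 * Real.pi), k θ = 0 := by
    intro θ hθ
    by_contra hne
    have hpos := intervalIntegral.integral_pos Real.two_pi_pos hkc.continuousOn
      (fun x _ => hk0 x) ⟨θ, hθ, lt_of_le_of_ne (hk0 θ) (Ne.symm hne)⟩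
    exact hpos.ne' h2
  ext z i j
  obtain ⟨θ, hθ, rfl⟩ : ∃ θ ∈ Icc 0 (2 * Real.pi), Circle.exp θ = z := by
    have hper : Function.Periodic Circle.exp (2 * Real.pi) := Circle.periodic_exp
    obtain ⟨θ₀, rfl⟩ : ∃ θ₀, Circle.exp θ₀ = z := ⟨_, Circle.exp_arg z⟩
    obtain ⟨y, hy, hy'⟩ := hper.exists_mem_Ico₀ Real.two_pi_pos θ₀
    exact ⟨y, Ico_subset_Icc_self hy, hy'.symm⟩
  have h3 := hk00 θ hθ
  have h4 := (Finset.sum_eq_zero_iff_of_nonneg fun i _ =>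
    Finset.sum_nonneg fun j _ => sq_nonneg _).mp h3 i (Finset.mem_univ i)
  have h5 := (Finset.sum_eq_zero_iff_of_nonneg fun j _ => sq_nonneg _).mp h4 j (Finset.mem_univ j)
  simpa using h5

lemma summable_antiderivCoeff {a : ℕ → ℝ} (ha : ∀ r : ℝ, Summable fun n => a n * r ^ n) (r : ℝ) :
    Summable fun n => antiderivCoeff a n * r ^ n := by
  rw [← summable_nat_add_iff 1]
  refine Summable.of_norm_bounded ((ha r).abs.mul_right |r|) fun n => ?_
  have h : antiderivCoeff a (n + 1) * r ^ (n + 1) = (a n * r ^ n) * r / (n + 1) := by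
    simp only [antiderivCoeff]
    ring
  rw [h, Real.norm_eq_abs, abs_div, abs_mul]
  refine div_le_self (by positivity) ?_
  rw [abs_of_pos (by positivity)]
  linarith [(Nat.cast_nonneg n : (0 : ℝ) ≤ n)]

/-- The derivative of the trace of an entire function. -/
lemma hasDerivAt_trace_entireSum {𝔸 : Type*} [NormedRing 𝔸] [NormedAlgebra ℝ 𝔸] [CompleteSpace 𝔸]
    {a : ℕ → ℝ} (ha : ∀ r : ℝ, Summable fun n => a n * r ^ n) (T : 𝔸 →L[ℝ] ℂ)
    (hT : ∀ X Y, T (X * Y) = T (Y * X)) (P Q : 𝔸) :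
    HasDerivAt (fun τ : ℝ => T (entireSum (antiderivCoeff a) (P + τ • Q)))
      (T (entireSum a P * Q)) 0 := by
  have hsum : ∀ X : 𝔸, T (entireSum (antiderivCoeff a) X) =
      ∑' n : ℕ, (a n / (n + 1)) • T (X ^ (n + 1)) := by
    intro X
    have hs := summable_smul_pow (summable_antiderivCoeff ha) X
    rw [entireSum, hs.tsum_eq_zero_add, antiderivCoeff, zero_smul, zero_add,
      ContinuousLinearMap.map_tsum _ ((summable_nat_add_iff 1).mpr hs)]
    simp [antiderivCoeff]
  have hsum' : T (entireSum a P * Q) = ∑' n : ℕ, a n • T ((P + (0 : ℝ) • Q) ^ n * Q) := by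
    have hs := summable_smul_pow ha P
    rw [entireSum, ← hs.tsum_mul_right, ContinuousLinearMap.map_tsum _ (hs.mul_right Q)]
    simp
  simp only [hsum]
  rw [hsum']
  refine hasDerivAt_tsum_of_isPreconnected (t := Ioo (-1) 1) (y₀ := 0)
    (g := fun (n : ℕ) (τ : ℝ) => (a n / (n + 1)) • T ((P + τ • Q) ^ (n + 1)))
    (g' := fun (n : ℕ) (τ : ℝ) => a n • T ((P + τ • Q) ^ n * Q))
    (((summable_abs_mul_pow ha (r := ‖P‖ + ‖Q‖) (by positivity)).mul_left
        (‖(1 : 𝔸)‖ + 1)).mul_left (‖T‖ * ‖Q‖)) isOpen_Ioo isPreconnected_Ioo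
    (fun n τ _ => ?_) (fun n τ hτ => ?_) (by simp) ?_ (by simp)
  · have hx : HasDerivAt (fun τ : ℝ => P + τ • Q) Q τ := by
      simpa using ((hasDerivAt_id τ).smul_const Q).const_add P
    have h1 := (T.hasFDerivAt.comp_hasDerivAt τ (hx.fun_pow' (n + 1))).const_smul (a n / (n + 1))
    refine h1.congr_deriv ?_
    -- Cyclicity of `T` makes the `n + 1` terms of the noncommutative power rule equal, cancelling
    -- the denominator `n + 1`.
    have h2 : ∀ i ∈ Finset.range (n + 1), T ((P + τ • Q) ^ ((n + 1).pred - i) * Q *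
        (P + τ • Q) ^ i) = T ((P + τ • Q) ^ n * Q) := by
      intro i hi
      rw [hT, ← mul_assoc, ← pow_add]
      congr 3
      have := Finset.mem_range.mp hi
      simp only [Nat.pred_succ]
      omega
    rw [map_sum, Finset.sum_congr rfl h2, Finset.sum_const, Finset.card_range,
      ← Nat.cast_smul_eq_nsmul ℝ, smul_smul]
    congr 1
    push_cast
    field_simp
  · have hb : ‖P + τ • Q‖ ≤ ‖P‖ + ‖Q‖ := by
      have hτ' : ‖τ‖ ≤ 1 := abs_le.mpr ⟨hτ.1.le, hτ.2.le⟩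
      calc ‖P + τ • Q‖ ≤ ‖P‖ + ‖τ • Q‖ := norm_add_le _ _
        _ ≤ ‖P‖ + 1 * ‖Q‖ := by rw [norm_smul]; gcongr
        _ = _ := by rw [one_mul]
    calc ‖a n • T ((P + τ • Q) ^ n * Q)‖ = ‖T ((a n • (P + τ • Q) ^ n) * Q)‖ := by
          rw [smul_mul_assoc, map_smul]
      _ ≤ ‖T‖ * (‖a n • (P + τ • Q) ^ n‖ * ‖Q‖) :=
          (T.le_opNorm _).trans (by gcongr; exact norm_mul_le _ _)
      _ ≤ ‖T‖ * (((‖(1 : 𝔸)‖ + 1) * (|a n| * (‖P‖ + ‖Q‖) ^ n)) * ‖Q‖) := by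
          gcongr
          exact norm_smul_pow_le a _ hb n
      _ = _ := by ring
  · have hs := (summable_nat_add_iff 1).mpr
      (summable_smul_pow (summable_antiderivCoeff ha) (P + (0 : ℝ) • Q))
    simpa [antiderivCoeff] using T.summable hs

section

variable {a : ℕ → ℝ} (ha : ∀ r : ℝ, Summable fun n => a n * r ^ n)
include ha

lemma isRealLoop_gradLoop {X : Loop N} (hX : IsRealLoop X) : IsRealLoop (gradLoop a X) :=
  (realLoops N).mul_mem (isRealLoop_zpowLoop 1) (isRealLoop_entireSum ha
    ((realLoops N).mul_mem hX (isRealLoop_zpowLoop (-1))))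

/-- One `z⁻¹` from the argument `X / z` cancels against the weight `z²`, leaving the factor `z` of
the gradient. -/
lemma hasDerivAt_hamiltonian (X Y : Loop N) :
    HasDerivAt (fun τ : ℝ => hamiltonian a (X + τ • Y)) (pairing (gradLoop a X) Y) 0 := by
  have h := hasDerivAt_trace_entireSum ha (pairingRight (zpowLoop N 2))
    (fun X Y => pairing_mul_comm (commute_zpowLoop 2) X Y) (X * zpowLoop N (-1))
    (Y * zpowLoop N (-1))
  have h1 : pairing (gradLoop a X) Y =
      pairing (entireSum a (X * zpowLoop N (-1)) * (Y * zpowLoop N (-1))) (zpowLoop N 2) := by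
    rw [gradLoop, (commute_zpowLoop 1 _).eq, pairing_mul_assoc, pairing_mul_assoc, mul_assoc,
      zpowLoop_mul, (commute_zpowLoop 1 Y).eq]
    norm_num
  rw [h1]
  simpa only [pairingRight_apply, hamiltonian, entireEval_eq, add_mul, smul_mul_assoc] using h

lemma isGradientAt_hamiltonian_iff {X : Loop N} (hX : IsRealLoop X) (G : Loop N) :
    IsGradientAt (hamiltonian a) X G ↔ G = gradLoop a X := by
  constructor
  · rintro ⟨hG, h⟩
    rw [← sub_eq_zero]
    refine eq_zero_of_pairing_eq_zero ((realLoops N).sub_mem hG (isRealLoop_gradLoop ha hX))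
      fun Y hY => ?_
    have h1 := (h Y hY).unique (hasDerivAt_hamiltonian ha X Y)
    rw [← pairingRight_apply, map_sub, pairingRight_apply, pairingRight_apply, h1, sub_self]
  · rintro rfl
    exact ⟨isRealLoop_gradLoop ha hX, fun Y _ => hasDerivAt_hamiltonian ha X Y⟩

end

/-! ### Local existence of the factorization -/

/-- Real matrices as constant loops. -/
def constLoop (N : ℕ) : (Fin N → Fin N → ℝ) →L[ℝ] Loop N where
  toFun A := ContinuousMap.const _ (toComplex (Matrix.of A))
  map_add' A B := by
    ext z i j
    simp [toComplex]
  map_smul' c A := by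
    ext z i j
    simp [toComplex]
  cont := by
    refine ContinuousMap.continuous_const'.comp ?_
    exact Continuous.matrix_map (f := Complex.ofReal) continuous_id Complex.continuous_ofReal

lemma constLoop_apply (A : Fin N → Fin N → ℝ) (z : Circle) :
    constLoop N A z = toComplex (Matrix.of A) := rfl

lemma laxLoop_eq (u : Fin N → ℝ) (A : Fin N → Fin N → ℝ) :
    laxLoop u (Matrix.of A) = laxLoop u 0 - constLoop N A := by
  ext1 z
  simp [laxLoop_apply, constLoop_apply, toComplex]

lemma fieldLoop_eq (u : Fin N → ℝ) (f : ℝ → ℝ) (A : Matrix (Fin N) (Fin N) ℝ) :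
    fieldLoop u f A = fieldLoop u f 0 + constLoop N (fun i j => companion u f A i j) := by
  ext z i j
  by_cases hij : i = j <;>
    simp [fieldLoop_apply, constLoop_apply, toComplex, companion, hij]

/-- The `z`-dependence of the Lax bracket cancels. -/
lemma lax_bracket {u : Fin N → ℝ} (hu : Function.Injective u) (f : ℝ → ℝ)
    (A : Matrix (Fin N) (Fin N) ℝ) (z : ℂ) :
    ⁅toComplex A - z • Mu u, toComplex (companion u f A) + z • Mu (f ∘ u)⁆ =
      toComplex ⁅A, companion u f A⁆ := by
  have h1 : toComplex ⁅A, companion u f A⁆ = ⁅toComplex A, toComplex (companion u f A)⁆ := by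
    have h : ∀ B C : Matrix (Fin N) (Fin N) ℝ, toComplex (B * C) = toComplex B * toComplex C :=
      fun B C => Matrix.map_mul (f := Complex.ofRealHom)
    rw [Ring.lie_def, Ring.lie_def, ← h, ← h]
    exact Matrix.map_sub _ (by simp) _ _
  have h2 : Mu u * Mu (f ∘ u) = Mu (f ∘ u) * Mu u := by
    rw [Mu, Mu, Matrix.diagonal_mul_diagonal, Matrix.diagonal_mul_diagonal]
    congr 1
    ext i
    exact mul_comm _ _
  -- The coefficient of `z` vanishes because `[A, M_f] = [M_u, B]`, which is how the off-diagonal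
  -- part of `B` is defined; the `z²` coefficient is `h2`.
  have h3 : toComplex A * Mu (f ∘ u) - Mu (f ∘ u) * toComplex A =
      Mu u * toComplex (companion u f A) - toComplex (companion u f A) * Mu u := by
    ext i j
    simp only [Mu, Matrix.sub_apply, Matrix.mul_diagonal, Matrix.diagonal_mul, toComplex,
      Matrix.map_apply, Function.comp_apply]
    by_cases hij : i = j
    · subst hij
      ring
    · have hne : (u i : ℂ) - u j ≠ 0 := by
        rw [sub_ne_zero]
        exact_mod_cast fun h => hij (hu h)
      rw [companion_apply_of_ne u f A hij]
      push_cast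
      field_simp
      ring
  rw [h1, Ring.lie_def, Ring.lie_def]
  simp only [sub_mul, mul_sub, add_mul, mul_add, Matrix.smul_mul, Matrix.mul_smul]
  linear_combination (norm := module) z • h3 - (z * z) • h2

lemma contDiff_companion (u : Fin N → ℝ) (f : ℝ → ℝ) :
    ContDiff ℝ ∞ fun A : Fin N → Fin N → ℝ => fun i j => companion u f (Matrix.of A) i j := by
  refine contDiff_pi.mpr fun i => contDiff_pi.mpr fun j => ?_
  have h : ∀ i j, ContDiff ℝ ∞ fun A : Fin N → Fin N → ℝ => A i j := fun i j =>
    contDiff_apply_apply ℝ ℝ i j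
  by_cases hij : i = j
  · simp only [companion, Matrix.of_apply, if_pos hij]
    exact (ContDiff.sum fun k _ => contDiff_const.mul (h i k)).neg
  · simp only [companion, Matrix.of_apply, if_neg hij]
    exact contDiff_const.mul (h i j)

/-- The vector field of the system `A' = [A, B]`, `g' = -(z M_f + B) g`. -/
def laxField (u : Fin N → ℝ) (f : ℝ → ℝ) (p : (Fin N → Fin N → ℝ) × Loop N) :
    (Fin N → Fin N → ℝ) × Loop N :=
  (fun i j => ⁅Matrix.of p.1, companion u f (Matrix.of p.1)⁆ i j,
    -fieldLoop u f (Matrix.of p.1) * p.2)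

lemma contDiff_laxField (u : Fin N → ℝ) (f : ℝ → ℝ) : ContDiff ℝ ∞ (laxField u f) := by
  have hc : ContDiff ℝ ∞ fun p : (Fin N → Fin N → ℝ) × Loop N =>
      fun i j => companion u f (Matrix.of p.1) i j := (contDiff_companion u f).comp contDiff_fst
  refine ContDiff.prodMk ?_ (ContDiff.mul (ContDiff.neg ?_) contDiff_snd)
  · refine contDiff_pi.mpr fun i => contDiff_pi.mpr fun j => ?_
    have h : ∀ i j, ContDiff ℝ ∞ fun p : (Fin N → Fin N → ℝ) × Loop N => p.1 i j := fun i j =>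
      (contDiff_apply_apply ℝ ℝ i j).comp contDiff_fst
    have h' : ∀ i j, ContDiff ℝ ∞ fun p : (Fin N → Fin N → ℝ) × Loop N =>
        companion u f (Matrix.of p.1) i j := fun i j => contDiff_pi.mp (contDiff_pi.mp hc i) j
    simp only [Ring.lie_def, Matrix.sub_apply, Matrix.mul_apply, Matrix.of_apply]
    exact (ContDiff.sum fun k _ => (h i k).mul (h' k j)).sub
      (ContDiff.sum fun k _ => (h' i k).mul (h k j))
  · simp only [fieldLoop_eq u f (Matrix.of _)]
    exact contDiff_const.add ((constLoop N).contDiff.comp hc)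

/-- The Lax equation as an equation between loops. -/
lemma constLoop_lie {u : Fin N → ℝ} (hu : Function.Injective u) (f : ℝ → ℝ)
    (A : Matrix (Fin N) (Fin N) ℝ) :
    -constLoop N (fun i j => ⁅A, companion u f A⁆ i j) =
      laxLoop u A * fieldLoop u f A - fieldLoop u f A * laxLoop u A := by
  ext1 z
  have h := lax_bracket hu f A z
  have h1 : constLoop N (fun i j => ⁅A, companion u f A⁆ i j) z = toComplex ⁅A, companion u f A⁆ :=
    rfl
  rw [ContinuousMap.neg_apply, h1, ← h, ContinuousMap.sub_apply, ContinuousMap.mul_apply,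
    ContinuousMap.mul_apply, laxLoop_apply, fieldLoop_apply, Ring.lie_def]
  generalize (z : ℂ) • Mu u = P, (z : ℂ) • Mu (f ∘ u) = Q
  noncomm_ring

/-- The scalar loops `z ^ k` are central and conjugation passes through power series. -/
lemma gradLoop_conj {a : ℕ → ℝ} (ha : ∀ r : ℝ, Summable fun n => a n * r ^ n) (g : (Loop N)ˣ)
    (X : Loop N) : gradLoop a (Ad g X) = Ad g (gradLoop a X) := by
  have h1 := (commute_zpowLoop (-1) ((g⁻¹ : (Loop N)ˣ) : Loop N)).eq
  have h2 := (commute_zpowLoop 1 (g : Loop N)).eq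
  rw [gradLoop, gradLoop, Ad, Ad, mul_assoc _ _ (zpowLoop N (-1)), ← h1, ← mul_assoc,
    mul_assoc (g : Loop N) X, entireSum_conj ha]
  simp only [← mul_assoc, h2]

lemma commute_gradLoop (a : ℕ → ℝ) (X : Loop N) : Commute X (gradLoop a X) := by
  refine Commute.mul_right (commute_zpowLoop 1 X).symm ?_
  have h := commute_entireSum a (X * zpowLoop N (-1))
  have h1 : X = X * zpowLoop N (-1) * zpowLoop N 1 := by
    rw [mul_assoc, zpowLoop_mul]
    norm_num [zpowLoop_zero]
  have h2 := h.mul_left (commute_zpowLoop 1 (entireSum a (X * zpowLoop N (-1))))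
  rwa [← h1] at h2

lemma hasDerivAt_exp_smul (G : Loop N) (t : ℝ) :
    HasDerivAt (fun s : ℝ => NormedSpace.exp (s • G)) (NormedSpace.exp (t • G) * G) t :=
  hasDerivAt_exp_smul_const G t

lemma contDiff_exp_smul (G : Loop N) : ContDiff ℝ ∞ fun t : ℝ => NormedSpace.exp (t • G) :=
  contDiffOn_univ.mp (contDiffOn_of_hasDerivAt (v := fun x => x * G)
    (contDiff_id.mul contDiff_const) isOpen_univ fun t _ => hasDerivAt_exp_smul G t)

lemma exp_zero_smul {𝔸 : Type*} [NormedRing 𝔸] [NormedAlgebra ℝ 𝔸] (G : 𝔸) :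
    NormedSpace.exp ((0 : ℝ) • G) = 1 := by
  rw [zero_smul, NormedSpace.exp_zero]

lemma intertwining_identity {R : Type*} [Ring R] (F X Y g : R) :
    -F * g * Y - ((X * F - F * X) * g + X * (-F * g)) = -F * (g * Y - X * g) := by
  noncomm_ring

lemma exists_isFactorization {u : Fin N → ℝ} (hu : Function.Injective u) {f : ℝ → ℝ}
    {a : ℕ → ℝ} (ha : ∀ r : ℝ, Summable fun n => a n * r ^ n)
    (haf : ∀ i, HasSum (fun n => a n * u i ^ n) (f (u i))) (A₀ : Matrix (Fin N) (Fin N) ℝ) :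
    ∃ (I : Set ℝ) (gp gm : ℝ → (Loop N)ˣ),
      IsFactorization (gradLoop a (laxLoop u A₀)) I gp gm := by
  set G := gradLoop a (laxLoop u A₀) with hG
  obtain ⟨x, hx0, ε, hε, hx⟩ :=
    ((contDiff_laxField u f).contDiffAt.of_le
      (by exact_mod_cast le_top : (1 : WithTop ℕ∞) ≤ ∞)).exists_forall_mem_closedBall_exists_eq_forall_mem_Ioo_hasDerivAt₀
      (x₀ := ((fun i j => A₀ i j, 1) : (Fin N → Fin N → ℝ) × Loop N)) 0
  simp only [zero_sub, zero_add] at hx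
  have hsm := contDiffOn_of_hasDerivAt (contDiff_laxField u f) isOpen_Ioo hx
  set A : ℝ → Matrix (Fin N) (Fin N) ℝ := fun t => Matrix.of (x t).1 with hA
  set g : ℝ → Loop N := fun t => (x t).2 with hg
  have hgsm : ContDiffOn ℝ ∞ g (Ioo (-ε) ε) := hsm.snd
  set e : ℝ → Loop N := fun t => NormedSpace.exp (t • G) with he
  have hesm : ContDiff ℝ ∞ e := contDiff_exp_smul G
  have hg0 : g 0 = 1 := by simp [hg, hx0]
  have he0 : e 0 = 1 := exp_zero_smul G
  have hA0 : A 0 = A₀ := by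
    ext i j
    simp [hA, hx0]
  have h0ε : (0 : ℝ) ∈ Ioo (-ε) ε := by simp [hε]
  have hF : ContinuousOn (fun t => fieldLoop u f (A t)) (Ioo (-ε) ε) := by
    simp only [fieldLoop_eq u f (A _)]
    refine continuousOn_const.add ((constLoop N).continuous.comp_continuousOn ?_)
    exact (contDiff_companion u f).continuous.comp_continuousOn hsm.continuousOn.fst
  have hg' : ∀ t ∈ Ioo (-ε) ε, HasDerivAt g (-fieldLoop u f (A t) * g t) t := fun t ht =>
    (hx t ht).snd
  have hX' : ∀ t ∈ Ioo (-ε) ε, HasDerivAt (fun s => laxLoop u (A s))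
      (laxLoop u (A t) * fieldLoop u f (A t) - fieldLoop u f (A t) * laxLoop u (A t)) t := by
    intro t ht
    rw [← constLoop_lie hu]
    simp only [hA, laxLoop_eq]
    exact ((constLoop N).hasFDerivAt.comp_hasDerivAt t (hx t ht).fst).const_sub _
  -- The difference `h` of the two sides solves `h' = -(z M_f + B) h` with `h(0) = 0`.
  have hint : ∀ t ∈ Ioo (-ε) ε, g t * laxLoop u A₀ = laxLoop u (A t) * g t := by
    intro t ht
    rw [← sub_eq_zero]
    refine eq_zero_of_deriv_bound ordConnected_Ioo h0ε
      (h := fun s => g s * laxLoop u A₀ - laxLoop u (A s) * g s)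
      (h' := fun s => -fieldLoop u f (A s) * (g s * laxLoop u A₀ - laxLoop u (A s) * g s))
      (fun s hs => ?_) hF.norm (fun s _ => ?_) (by simp [hg0, hA0]) ht
    · refine (((hg' s hs).mul_const _).sub ((hX' s hs).mul (hg' s hs))).congr_deriv ?_
      exact intertwining_identity _ _ _ _
    · simpa using norm_mul_le (-fieldLoop u f (A s)) _
  have hge : ContinuousOn (fun t => g t * e t) (Ioo (-ε) ε) :=
    hgsm.continuousOn.mul hesm.continuous.continuousOn
  have hnear : ∀ h : ℝ → Loop N, ContinuousOn h (Ioo (-ε) ε) → h 0 = 1 →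
      ∀ᶠ t in 𝓝 (0 : ℝ), ‖h t - 1‖ < 1 := by
    intro h hc h1
    have : Tendsto (fun t => ‖h t - 1‖) (𝓝 0) (𝓝 ‖h 0 - 1‖) :=
      ((hc.continuousAt (isOpen_Ioo.mem_nhds h0ε)).sub continuousAt_const).norm
    refine this.eventually_lt_const ?_
    simp [h1]
  -- The interval is shrunk until both prospective factors are within distance `1` of the identity.
  obtain ⟨δ, hδ, hball⟩ := Metric.eventually_nhds_iff_ball.mp
    (((hnear g hgsm.continuousOn hg0).and (hnear _ hge (by simp [hg0, he0]))).and
      (isOpen_Ioo.mem_nhds h0ε))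
  rw [Real.ball_eq_Ioo, zero_sub, zero_add] at hball
  have hsub : Ioo (-δ) δ ⊆ Ioo (-ε) ε := fun t ht => (hball t ht).2
  have h0δ : (0 : ℝ) ∈ Ioo (-δ) δ := by simp [hδ]
  have hunit : ∀ t, ∃ U : (Loop N)ˣ, t ∈ Ioo (-δ) δ → (U : Loop N) = g t := by
    intro t
    by_cases ht : t ∈ Ioo (-δ) δ
    · have h1 := isUnit_one_sub_of_norm_lt_one (x := 1 - g t)
        (by rw [norm_sub_rev]; exact (hball t ht).1.1)
      rw [sub_sub_cancel] at h1
      exact ⟨h1.unit, fun _ => rfl⟩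
    · exact ⟨1, fun h => absurd h ht⟩
  choose gp hgp using hunit
  have hexp : ∀ t, ∃ U : (Loop N)ˣ, (U : Loop N) = e t := fun t =>
    ⟨(NormedSpace.isUnit_exp (t • G)).unit, rfl⟩
  choose ue hue using hexp
  have hAd : ∀ t ∈ Ioo (-δ) δ, gradLoop a (laxLoop u (A t)) * g t = g t * G := by
    intro t ht
    have h1 : laxLoop u (A t) = Ad (gp t) (laxLoop u A₀) := by
      rw [Ad, Units.eq_mul_inv_iff_mul_eq, hgp t ht, hint t (hsub ht)]
    rw [h1, gradLoop_conj ha, Ad, ← hG, ← hgp t ht, Units.inv_mul_cancel_right]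
  have hcoe : ∀ t ∈ Ioo (-δ) δ, ((gp t * ue t : (Loop N)ˣ) : Loop N) = g t * e t := fun t ht => by
    rw [Units.val_mul, hgp t ht, hue]
  have hR : ContinuousOn (fun t => gradLoop a (laxLoop u (A t)) - fieldLoop u f (A t))
      (Ioo (-δ) δ) := by
    -- Since `G(X_t) = g G g⁻¹`, continuity in `t` follows without continuity of the functional
    -- calculus.
    have hinv : ContinuousOn (fun t => g t * G * Ring.inverse (g t)) (Ioo (-δ) δ) := by
      refine ((hgsm.continuousOn.mono hsub).mul continuousOn_const).mul fun t ht => ?_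
      have h1 : ContinuousAt Ring.inverse (g t) := hgp t ht ▸ NormedRing.inverse_continuousAt (gp t)
      exact h1.comp_continuousWithinAt (hgsm.continuousOn.mono hsub t ht)
    refine (hinv.congr fun t ht => ?_).sub (hF.mono hsub)
    rw [← hAd t ht, mul_assoc, Ring.mul_inverse_cancel _ (hgp t ht ▸ (gp t).isUnit), mul_one]
  have hplus : ∀ t ∈ Ioo (-δ) δ, g t - 1 ∈ algPlus N := fun t ht =>
    sub_one_mem_of_hasDerivAt (algPlus N) isClosed_algPlus ordConnected_Ioo h0ε hg' hF.neg
      (fun s _ => (algPlus N).neg_mem (fieldLoop_mem_algPlus u f _))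
      (fun s _ v hv => algPlus_mul_mem ((algPlus N).neg_mem (fieldLoop_mem_algPlus u f _)) hv)
      hg0 (hsub ht)
  have hminus : ∀ t ∈ Ioo (-δ) δ, g t * e t - 1 ∈ algMinus N := fun t ht => by
    refine sub_one_mem_of_hasDerivAt (algMinus N) isClosed_algMinus ordConnected_Ioo h0δ
      (g := fun t => g t * e t) (fun s hs => ?_) hR
      (fun s _ => gradLoop_sub_fieldLoop_mem ha hu haf (A s))
      (fun s _ v hv => algMinus_mul_mem (gradLoop_sub_fieldLoop_mem ha hu haf (A s)) hv)
      (by simp [hg0, he0]) ht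
    -- With `g G = G(X_s) g`, the product rule gives `(g e)' = (G(X_s) - (z M_f + B)) g e`.
    refine ((hg' s (hsub hs)).mul (hasDerivAt_exp_smul G s)).congr_deriv ?_
    have hcomm : NormedSpace.exp (s • G) * G = G * e s :=
      ((Commute.refl G).smul_left s).exp_left.eq
    rw [hcomm, ← mul_assoc, ← hAd s hs]
    simp only [he]
    noncomm_ring
  refine ⟨Ioo (-δ) δ, gp, fun t => gp t * ue t, isOpen_Ioo, ordConnected_Ioo, h0δ, ?_, ?_, ?_, ?_,
    ?_, ?_, ?_⟩
  · intro t ht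
    refine mem_loopGroupPlus_of_norm_lt ?_ ?_ <;> rw [hgp t ht]
    exacts [hplus t ht, (hball t ht).1.1]
  · intro t ht
    refine mem_loopGroupMinus_of_norm_lt ?_ ?_ <;> rw [hcoe t ht]
    exacts [hminus t ht, (hball t ht).1.2]
  · exact (hgsm.mono hsub).congr fun t ht => hgp t ht
  · exact ((hgsm.mono hsub).mul hesm.contDiffOn).congr fun t ht => hcoe t ht
  · exact Units.ext (by rw [hgp 0 h0δ, hg0, Units.val_one])
  · exact Units.ext (by rw [hcoe 0 h0δ, hg0, he0, Units.val_one, one_mul])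
  · intro t _
    rw [inv_mul_cancel_left, hue]

/-! ### The maximal factorization -/

lemma IsFactorization.eq {G : Loop N} {I J : Set ℝ} {gp gm hp hm : ℝ → (Loop N)ˣ}
    (hg : IsFactorization G I gp gm) (hh : IsFactorization G J hp hm) {t : ℝ} (hI : t ∈ I)
    (hJ : t ∈ J) : hp t = gp t ∧ hm t = gm t :=
  eq_of_inv_mul_eq (hg.plus_mem t hI) (hg.minus_mem t hI) (hh.plus_mem t hJ) (hh.minus_mem t hJ)
    (Units.ext ((hh.factor t hJ).symm.trans (hg.factor t hI)))

lemma exists_isMaximalFactorization {G : Loop N}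
    (h : ∃ (I : Set ℝ) (gp gm : ℝ → (Loop N)ˣ), IsFactorization G I gp gm) :
    ∃ (I : Set ℝ) (gp gm : ℝ → (Loop N)ˣ), IsMaximalFactorization G I gp gm := by
  set S : Set (Set ℝ) := {J | ∃ hp hm, IsFactorization G J hp hm} with hS
  -- By uniqueness all factorizations reaching `t` share one value there; these values define the
  -- factorization on the union.
  have hval : ∀ t, ∃ p : (Loop N)ˣ × (Loop N)ˣ, ∀ J hp hm, IsFactorization G J hp hm → t ∈ J →
      hp t = p.1 ∧ hm t = p.2 := by
    intro t
    by_cases ht : ∃ J hp hm, IsFactorization G J hp hm ∧ t ∈ J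
    · obtain ⟨J, hp, hm, hJ, htJ⟩ := ht
      exact ⟨(hp t, hm t), fun J' hp' hm' hJ' htJ' => hJ.eq hJ' htJ htJ'⟩
    · exact ⟨1, fun J hp hm hJ htJ => absurd ⟨J, hp, hm, hJ, htJ⟩ ht⟩
  choose p hp using hval
  obtain ⟨I₀, gp₀, gm₀, h₀⟩ := h
  refine ⟨⋃₀ S, fun t => (p t).1, fun t => (p t).2, ⟨?_, ?_, ?_, ?_, ?_, ?_, ?_, ?_, ?_, ?_⟩, ?_⟩
  · exact isOpen_sUnion fun J ⟨_, _, hJ⟩ => hJ.isOpen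
  · refine IsPreconnected.ordConnected (isPreconnected_sUnion 0 S ?_ ?_)
    · exact fun J ⟨_, _, hJ⟩ => hJ.zero_mem
    · exact fun J ⟨_, _, hJ⟩ => hJ.ordConnected.isPreconnected
  · exact ⟨I₀, ⟨gp₀, gm₀, h₀⟩, h₀.zero_mem⟩
  · rintro t ⟨J, ⟨kp, km, hJ⟩, ht⟩
    exact (hp t J kp km hJ ht).1 ▸ hJ.plus_mem t ht
  · rintro t ⟨J, ⟨kp, km, hJ⟩, ht⟩
    exact (hp t J kp km hJ ht).2 ▸ hJ.minus_mem t ht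
  · rintro t ⟨J, ⟨kp, km, hJ⟩, ht⟩
    refine ((hJ.plus_smooth.contDiffAt (hJ.isOpen.mem_nhds ht)).congr_of_eventuallyEq
      ?_).contDiffWithinAt
    filter_upwards [hJ.isOpen.mem_nhds ht] with s hs
    rw [(hp s J kp km hJ hs).1]
  · rintro t ⟨J, ⟨kp, km, hJ⟩, ht⟩
    refine ((hJ.minus_smooth.contDiffAt (hJ.isOpen.mem_nhds ht)).congr_of_eventuallyEq
      ?_).contDiffWithinAt
    filter_upwards [hJ.isOpen.mem_nhds ht] with s hs
    rw [(hp s J kp km hJ hs).2]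
  · rw [← (hp 0 I₀ gp₀ gm₀ h₀ h₀.zero_mem).1, h₀.plus_zero]
  · rw [← (hp 0 I₀ gp₀ gm₀ h₀ h₀.zero_mem).2, h₀.minus_zero]
  · rintro t ⟨J, ⟨kp, km, hJ⟩, ht⟩
    rw [hJ.factor t ht, (hp t J kp km hJ ht).1, (hp t J kp km hJ ht).2]
  · exact fun J kp km hJ => ⟨fun t ht => ⟨J, ⟨kp, km, hJ⟩, ht⟩, fun t ht => hp t J kp km hJ ht⟩

/-! ### From the factorization to the Lax equation -/

/-- Integral curves of a `C¹` vector field on a finite-dimensional space are unique. -/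
lemma eq_of_hasDerivAt {E : Type*} [NormedAddCommGroup E] [NormedSpace ℝ E] [ProperSpace E]
    {v : E → E} (hv : ContDiff ℝ 1 v) {I : Set ℝ} (hI : I.OrdConnected) (h0 : (0 : ℝ) ∈ I)
    {x y : ℝ → E} (hx : ∀ t ∈ I, HasDerivAt x (v (x t)) t)
    (hy : ∀ t ∈ I, HasDerivAt y (v (y t)) t) (hxy : x 0 = y 0) {t : ℝ} (ht : t ∈ I) :
    x t = y t := by
  have hsub : uIcc 0 t ⊆ I := hI.uIcc_subset h0 ht
  have hxc : ContinuousOn x (uIcc 0 t) := fun s hs =>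
    (hx s (hsub hs)).continuousAt.continuousWithinAt
  have hyc : ContinuousOn y (uIcc 0 t) := fun s hs =>
    (hy s (hsub hs)).continuousAt.continuousWithinAt
  -- Both curves stay in a compact ball up to time `t`, where the derivative of `v` is bounded and
  -- gives a Lipschitz constant for Gronwall.
  obtain ⟨R, hR⟩ := ((isCompact_uIcc.image_of_continuousOn hxc).union
    (isCompact_uIcc.image_of_continuousOn hyc)).isBounded.subset_closedBall (0 : E)
  obtain ⟨C, hC⟩ := (isCompact_closedBall (0 : E) R).bddAbove_image
    (hv.continuous_fderiv one_ne_zero).norm.continuousOn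
  rw [← sub_eq_zero]
  refine eq_zero_of_deriv_bound (I := uIcc 0 t) ordConnected_uIcc left_mem_uIcc
    (h := fun s => x s - y s) (h' := fun s => v (x s) - v (y s)) (K := fun _ => C)
    (fun s hs => (hx s (hsub hs)).sub (hy s (hsub hs))) continuousOn_const (fun s hs => ?_)
    (sub_eq_zero.mpr hxy) right_mem_uIcc
  refine (convex_closedBall (0 : E) R).norm_image_sub_le_of_norm_fderiv_le
    (fun z _ => (hv.differentiable one_ne_zero).differentiableAt)
    (fun z hz => hC (mem_image_of_mem _ hz)) (hR (Or.inr (mem_image_of_mem y hs)))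
    (hR (Or.inl (mem_image_of_mem x hs)))

/-- The derivative of a conjugation along a curve of units. -/
lemma hasDerivAt_conj {𝔸 : Type*} [NormedRing 𝔸] [NormedAlgebra ℝ 𝔸] [CompleteSpace 𝔸]
    {g : ℝ → 𝔸ˣ} {F X : 𝔸} {t : ℝ} (hg : HasDerivAt (fun s => (g s : 𝔸)) (-F * g t) t) :
    HasDerivAt (fun s => g s * X * ((g s)⁻¹ : 𝔸ˣ))
      (g t * X * ((g t)⁻¹ : 𝔸ˣ) * F - F * (g t * X * ((g t)⁻¹ : 𝔸ˣ))) t := by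
  have hi : HasDerivAt (fun s => (((g s)⁻¹ : 𝔸ˣ) : 𝔸)) (((g t)⁻¹ : 𝔸ˣ) * F) t := by
    have h := (hasFDerivAt_ringInverse (𝕜 := ℝ) (g t)).comp_hasDerivAt t hg
    simp only [Function.comp_def, Ring.inverse_unit] at h
    refine h.congr_deriv ?_
    simp [mul_assoc]
  refine ((hg.mul_const X).mul hi).congr_deriv ?_
  noncomm_ring

/-- The logarithmic derivative of a curve of units whose increments lie in `1 + V`. -/
lemma deriv_mul_inv_mem {𝔸 : Type*} [NormedRing 𝔸] [NormedAlgebra ℝ 𝔸] (V : Submodule ℝ 𝔸)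
    (hV : IsClosed (V : Set 𝔸)) {g : ℝ → 𝔸ˣ} {D : 𝔸} {t : ℝ}
    (hg : HasDerivAt (fun s => (g s : 𝔸)) D t)
    (hgV : ∀ᶠ s in 𝓝 t, ((g s * (g t)⁻¹ : 𝔸ˣ) : 𝔸) - 1 ∈ V) : D * ((g t)⁻¹ : 𝔸ˣ) ∈ V := by
  have h := (hasDerivAt_iff_tendsto_slope.mp (hg.mul_const (((g t)⁻¹ : 𝔸ˣ) : 𝔸)))
  refine hV.mem_of_tendsto h ((hgV.filter_mono nhdsWithin_le_nhds).mono fun s hs => ?_)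
  rw [slope_def_module, Units.mul_inv]
  exact V.smul_mem _ (by simpa using hs)

lemma Ad_mul (g h : (Loop N)ˣ) (X : Loop N) : Ad (g * h) X = Ad g (Ad h X) := by
  simp only [Ad, Units.val_mul, mul_inv_rev, mul_assoc]

lemma toComplex_injective : Function.Injective (toComplex (N := N)) := fun A B h => by
  ext i j
  simpa [toComplex] using congrFun (congrFun h i) j

lemma laxLoop_injective (u : Fin N → ℝ) : Function.Injective (laxLoop u) := fun A B h => by
  have h1 : laxLoop u A 1 = laxLoop u B 1 := by rw [h]
  rw [laxLoop_apply, laxLoop_apply] at h1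
  exact toComplex_injective (sub_right_injective h1)

/-- A loop that is conjugate to `z M_u - A₀` under both subgroups is of the same form. -/
lemma exists_laxLoop_eq (u : Fin N → ℝ) {A₀ : Matrix (Fin N) (Fin N) ℝ}
    (hA₀ : A₀ ∈ markovAlgebra N) {gp gm : (Loop N)ˣ} (hgp : gp ∈ loopGroupPlus N)
    (hgm : gm ∈ loopGroupMinus N) (h : Ad gp (laxLoop u A₀) = Ad gm (laxLoop u A₀)) :
    ∃ A ∈ markovAlgebra N, Ad gp (laxLoop u A₀) = laxLoop u A := by
  obtain ⟨hr, E, hE, hEg, hE0⟩ := hgp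
  obtain ⟨-, E', hE', hEg', hE0'⟩ := hgm
  have hcl : closure (ball (0 : ℂ) 1) = closedBall 0 1 := closure_ball 0 one_ne_zero
  have hnhds : ball (0 : ℂ) 1 ∈ 𝓝 0 := ball_mem_nhds 0 one_pos
  have hmul : ∀ {P Q : ℂ → Matrix (Fin N) (Fin N) ℂ}, DiffContOnCl ℂ P (ball 0 1) →
      DiffContOnCl ℂ Q (ball 0 1) → DiffContOnCl ℂ (fun z => P z * Q z) (ball 0 1) :=
    fun hP hQ => ⟨hP.1.mul hQ.1, hP.2.mul hQ.2⟩
  -- `P` extends the conjugated loop inside the disc; `Q`, in `w = 1 / z`, extends `z⁻¹` times it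
  -- outside.
  set P : ℂ → Matrix (Fin N) (Fin N) ℂ := fun z =>
    E z * (z • Mu u - toComplex A₀) * Ring.inverse (E z) with hPdef
  set Q : ℂ → Matrix (Fin N) (Fin N) ℂ := fun w =>
    E' w * (Mu u - w • toComplex A₀) * Ring.inverse (E' w) with hQdef
  have hP : DiffContOnCl ℂ P (ball 0 1) :=
    hmul (hmul hE.1 (Differentiable.diffContOnCl (by fun_prop))) hE.inverse.1
  have hQ : DiffContOnCl ℂ Q (ball 0 1) :=
    hmul (hmul hE'.1 (Differentiable.diffContOnCl (by fun_prop))) hE'.inverse.1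
  have hPX : ∀ z : Circle, P z = Ad gp (laxLoop u A₀) z := fun z => by
    simp only [hPdef, Ad, ContinuousMap.mul_apply, laxLoop_apply, coe_inv_apply, hEg]
  have hQX : ∀ z : Circle, Q ((z⁻¹ : Circle) : ℂ) = (z : ℂ)⁻¹ • Ad gp (laxLoop u A₀) z := by
    intro z
    have hz : (z : ℂ) ≠ 0 := Circle.coe_ne_zero z
    have h1 : Mu u - (z : ℂ)⁻¹ • toComplex A₀ =
        (z : ℂ)⁻¹ • ((z : ℂ) • Mu u - toComplex A₀) := by
      rw [smul_sub, smul_smul, inv_mul_cancel₀ hz, one_smul]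
    rw [h]
    simp only [hQdef, Ad, ContinuousMap.mul_apply, laxLoop_apply, coe_inv_apply, hEg']
    rw [Circle.coe_inv, h1, Matrix.mul_smul, Matrix.smul_mul]
  have hP1 : DiffContOnCl ℂ (dslope P 0) (ball 0 1) := by
    have hd : DifferentiableAt ℂ P 0 := hP.1.differentiableAt hnhds
    refine ⟨(Complex.differentiableOn_dslope hnhds).mpr hP.1, ?_⟩
    exact (continuousOn_dslope (mem_of_superset hnhds subset_closure)).mpr ⟨hP.2, hd⟩
  have hQ1 : DiffContOnCl ℂ (fun w => Q w - w • P 0) (ball 0 1) :=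
    hQ.sub (Differentiable.diffContOnCl (by fun_prop))
  -- The value of the minus factor at `∞` is diagonal, so it commutes with `M_u`.
  have hQ0 : Q 0 = Mu u := by
    have hcomm : E' 0 * Mu u = Mu u * E' 0 := by
      rw [← hE0'.diagonal_diag, Mu, Matrix.diagonal_mul_diagonal, Matrix.diagonal_mul_diagonal]
      congr 1
      ext i
      exact mul_comm _ _
    simp only [hQdef, zero_smul, sub_zero]
    rw [hcomm, mul_assoc, Ring.mul_inverse_cancel _ (hE'.2 0 (by simp)), mul_one]
  have hconst : ∀ z : Circle, Ad gp (laxLoop u A₀) z = (z : ℂ) • Mu u + P 0 := by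
    intro z
    have hz : (z : ℂ) ≠ 0 := Circle.coe_ne_zero z
    -- Liouville for `(X(z) - P(0)) / z`, with `X` the conjugated loop: it extends to both sides,
    -- hence is constantly its value `M_u` at `∞`.
    have h1 := eq_of_eqOn_circle hP1 hQ1 (fun z => by
      have hz : (z : ℂ) ≠ 0 := Circle.coe_ne_zero z
      rw [dslope_of_ne _ hz, slope_def_module, hPX, hQX, Circle.coe_inv, sub_zero, smul_sub])
      z (by simp [Circle.norm_coe])
    rw [dslope_of_ne _ hz, slope_def_module, hPX, hQ0, zero_smul, sub_zero, sub_zero] at h1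
    rw [← h1, smul_smul, mul_inv_cancel₀ hz, one_smul, sub_add_cancel]
  have hreal : IsRealLoop (Ad gp (laxLoop u A₀)) :=
    (realLoops N).mul_mem ((realLoops N).mul_mem hr (isRealLoop_laxLoop u A₀))
      ((loopGroup N).inv_mem hr)
  have hP0 : toComplex (Matrix.of fun i j => -(P 0 i j).re) = -P 0 := by
    have h1 := hreal 1
    rw [inv_one, hconst, map_add, map_conj_smul, Mu_eq_toComplex, map_conj_toComplex,
      inv_one] at h1
    have h2 := add_left_cancel h1
    ext i j
    have h3 := congrFun (congrFun h2 i) j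
    simp only [RingHom.mapMatrix_apply, Matrix.map_apply] at h3
    simp only [toComplex, Matrix.map_apply, Matrix.of_apply, Matrix.neg_apply]
    push_cast
    rw [Complex.conj_eq_iff_re.mp h3.symm]
  refine ⟨Matrix.of fun i j => -(P 0 i j).re, ?_, ?_⟩
  · rw [← toComplex_mulVec_one, hP0, Matrix.neg_mulVec, neg_eq_zero]
    have hinv : Ring.inverse (E 0) *ᵥ 1 = 1 := by
      have h1 := Ring.inverse_mul_cancel _ (hE.2 0 (by simp))
      conv_lhs => rw [← hE0]
      rw [Matrix.mulVec_mulVec, h1, Matrix.one_mulVec]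
    simp only [hPdef, zero_smul, zero_sub]
    rw [← Matrix.mulVec_mulVec, hinv, ← Matrix.mulVec_mulVec, Matrix.neg_mulVec,
      toComplex_mulVec_one.mpr hA₀, neg_zero, Matrix.mulVec_zero]
  · ext1 z
    rw [hconst, laxLoop_apply, hP0, sub_neg_eq_add]

/-- `X₀` commutes with its gradient, hence with `exp(tG) = g_+⁻¹ g_-`. -/
lemma IsFactorization.Ad_eq {a : ℕ → ℝ} {X₀ : Loop N} {I : Set ℝ} {gp gm : ℝ → (Loop N)ˣ}
    (h : IsFactorization (gradLoop a X₀) I gp gm) {t : ℝ} (ht : t ∈ I) :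
    Ad (gp t) X₀ = Ad (gm t) X₀ := by
  have h1 : Commute X₀ (((gp t)⁻¹ * gm t : (Loop N)ˣ) : Loop N) := by
    rw [← h.factor t ht]
    exact ((commute_gradLoop a X₀).smul_right t).exp_right
  have h2 : Ad ((gp t)⁻¹ * gm t) X₀ = X₀ := by
    rw [Ad, ← h1.eq, Units.mul_inv_cancel_right]
  conv_lhs => rw [← h2]
  rw [← Ad_mul, mul_inv_cancel_left]

/-- For `p = g_+` and `e = exp(tG)` this reads `g_-' g_-⁻¹ = g_+' g_+⁻¹ + Ad_{g_+} G`. -/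
lemma log_deriv_identity {R : Type*} [Ring R] {p e : Rˣ} {D G M : R}
    (h : D * e + p * (e * G) = M) (hG : Commute (e : R) G) :
    M * ((p * e)⁻¹ : Rˣ) = D * (p⁻¹ : Rˣ) + p * G * (p⁻¹ : Rˣ) := by
  rw [← h, hG.eq, mul_inv_rev, Units.val_mul, add_mul]
  simp only [mul_assoc, Units.mul_inv_cancel_left]

/-- The plus factor solves `g' = -(z M_f + B) g`. -/
lemma IsFactorization.hasDerivAt_plus {u : Fin N → ℝ} (hu : Function.Injective u) {f : ℝ → ℝ}
    {a : ℕ → ℝ} (ha : ∀ r : ℝ, Summable fun n => a n * r ^ n)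
    (haf : ∀ i, HasSum (fun n => a n * u i ^ n) (f (u i))) {X₀ : Loop N} {I : Set ℝ}
    {gp gm : ℝ → (Loop N)ˣ} (h : IsFactorization (gradLoop a X₀) I gp gm) {t : ℝ} (ht : t ∈ I)
    {A : Matrix (Fin N) (Fin N) ℝ} (hA : Ad (gp t) X₀ = laxLoop u A) :
    HasDerivAt (fun s => (gp s : Loop N)) (-fieldLoop u f A * gp t) t := by
  have hI : I ∈ 𝓝 t := h.isOpen.mem_nhds ht
  have hp : HasDerivAt (fun s => (gp s : Loop N)) (deriv (fun s => (gp s : Loop N)) t) t :=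
    ((h.plus_smooth.contDiffAt hI).differentiableAt (by simp)).hasDerivAt
  have hm : HasDerivAt (fun s => (gm s : Loop N)) (deriv (fun s => (gm s : Loop N)) t) t :=
    ((h.minus_smooth.contDiffAt hI).differentiableAt (by simp)).hasDerivAt
  set D := deriv (fun s => (gp s : Loop N)) t
  set M := deriv (fun s => (gm s : Loop N)) t
  have hDV : D * ((gp t)⁻¹ : (Loop N)ˣ) ∈ algPlus N :=
    deriv_mul_inv_mem _ isClosed_algPlus hp (by
      filter_upwards [hI] with s hs
      exact sub_one_mem_algPlus (mul_mem (h.plus_mem s hs) (inv_mem (h.plus_mem t ht))))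
  have hMV : M * ((gm t)⁻¹ : (Loop N)ˣ) ∈ algMinus N :=
    deriv_mul_inv_mem _ isClosed_algMinus hm (by
      filter_upwards [hI] with s hs
      exact (algMinus N).sub_mem
        (mem_algMinus_of_mem (mul_mem (h.minus_mem s hs) (inv_mem (h.minus_mem t ht))))
        one_mem_algMinus)
  have hDM : D * (((gp t)⁻¹ * gm t : (Loop N)ˣ) : Loop N) +
      gp t * ((((gp t)⁻¹ * gm t : (Loop N)ˣ) : Loop N) * gradLoop a X₀) = M := by
    have h1 := hp.mul (hasDerivAt_exp_smul (gradLoop a X₀) t)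
    rw [h.factor t ht] at h1
    refine h1.unique (hm.congr_of_eventuallyEq ?_)
    filter_upwards [hI] with s hs
    simp only [Pi.mul_apply]
    rw [h.factor s hs, ← Units.val_mul, mul_inv_cancel_left]
  have hcomm : Commute (((gp t)⁻¹ * gm t : (Loop N)ˣ) : Loop N) (gradLoop a X₀) := by
    rw [← h.factor t ht]
    exact ((Commute.refl (gradLoop a X₀)).smul_left t).exp_left
  have hlog := log_deriv_identity hDM hcomm
  rw [mul_inv_cancel_left] at hlog
  have hAd : (gp t : Loop N) * gradLoop a X₀ * ((gp t)⁻¹ : (Loop N)ˣ) =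
      gradLoop a (laxLoop u A) := by
    rw [← hA, gradLoop_conj ha, Ad]
  rw [hAd] at hlog
  -- The left side is visibly in the plus algebra, and it equals `g_-' g_-⁻¹ - (G(X_t) - (z M_f +
  -- B))`, which is in the minus algebra.
  have hzero : D * ((gp t)⁻¹ : (Loop N)ˣ) + fieldLoop u f A = 0 := by
    refine eq_zero_of_mem_algPlus_of_mem_algMinus
      ((algPlus N).add_mem hDV (fieldLoop_mem_algPlus u f A)) ?_
    have h1 := (algMinus N).sub_mem hMV (gradLoop_sub_fieldLoop_mem ha hu haf A)
    rw [hlog] at h1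
    convert h1 using 1
    abel
  refine hp.congr_deriv ?_
  rw [← eq_neg_of_add_eq_zero_left hzero, Units.inv_mul_cancel_right]

/-- Entrywise form of the Lax equation. -/
lemma IsLaxSolution.hasDerivAt {u : Fin N → ℝ} (hu : Function.Injective u) {f : ℝ → ℝ}
    {I : Set ℝ} {A : ℝ → Matrix (Fin N) (Fin N) ℝ} (h : IsLaxSolution u f I A) {t : ℝ}
    (ht : t ∈ I) :
    HasDerivAt (fun s => (fun i j => A s i j : Fin N → Fin N → ℝ))
      (fun i j => ⁅A t, companion u f (A t)⁆ i j) t := by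
  have h1 := h t ht 0
  rw [lax_bracket hu] at h1
  simp only [zero_smul, sub_zero] at h1
  rw [hasDerivAt_pi]
  intro i
  rw [hasDerivAt_pi]
  intro j
  let L : Matrix (Fin N) (Fin N) ℂ →ₗ[ℝ] ℝ :=
    { toFun := fun M => (M i j).re
      map_add' := fun _ _ => by simp
      map_smul' := fun _ _ => by simp }
  let L' : Matrix (Fin N) (Fin N) ℂ →L[ℝ] ℝ :=
    ⟨L, Complex.continuous_re.comp (Continuous.matrix_elem continuous_id i j)⟩
  exact L'.hasFDerivAt.comp_hasDerivAt t h1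

lemma IsLaxSolution.eq {u : Fin N → ℝ} (hu : Function.Injective u) {f : ℝ → ℝ}
    {I J : Set ℝ} {A A' : ℝ → Matrix (Fin N) (Fin N) ℝ} (hA : IsLaxSolution u f I A)
    (hA' : IsLaxSolution u f J A') (hI : I.OrdConnected) (hJ : J.OrdConnected)
    (h0I : (0 : ℝ) ∈ I) (h0J : (0 : ℝ) ∈ J) (h0 : A' 0 = A 0) {t : ℝ} (ht : t ∈ I ∩ J) :
    A' t = A t := by
  have hv : ContDiff ℝ 1 fun x : Fin N → Fin N → ℝ =>
      (fun i j => ⁅Matrix.of x, companion u f (Matrix.of x)⁆ i j : Fin N → Fin N → ℝ) :=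
    -- The matrix component of `laxField` ignores the loop, so any constant, here `0`, may fill that
    -- slot.
    ((contDiff_laxField u f).fst.comp (contDiff_id.prodMk (contDiff_const (c := 0)))).of_le
      (by exact_mod_cast le_top)
  exact eq_of_hasDerivAt hv (hI.inter hJ) ⟨h0I, h0J⟩ (x := fun s i j => A' s i j)
    (y := fun s i j => A s i j) (fun s hs => hA'.hasDerivAt hu hs.2)
    (fun s hs => hA.hasDerivAt hu hs.1) h0 ht

lemma IsFactorization.exists_isLaxSolution {u : Fin N → ℝ} (hu : Function.Injective u)
    {f : ℝ → ℝ} {a : ℕ → ℝ} (ha : ∀ r : ℝ, Summable fun n => a n * r ^ n)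
    (haf : ∀ i, HasSum (fun n => a n * u i ^ n) (f (u i)))
    {A₀ : Matrix (Fin N) (Fin N) ℝ} (hA₀ : A₀ ∈ markovAlgebra N) {I : Set ℝ}
    {gp gm : ℝ → (Loop N)ˣ} (h : IsFactorization (gradLoop a (laxLoop u A₀)) I gp gm) :
    ∃ A : ℝ → Matrix (Fin N) (Fin N) ℝ, A 0 = A₀ ∧ IsLaxSolution u f I A ∧
      (∀ t ∈ I, A t ∈ markovAlgebra N) ∧
      ∀ t ∈ I, laxLoop u (A t) = Ad (gp t) (laxLoop u A₀) ∧
        laxLoop u (A t) = Ad (gm t) (laxLoop u A₀) := by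
  have hex : ∀ t, ∃ A, t ∈ I → A ∈ markovAlgebra N ∧
      Ad (gp t) (laxLoop u A₀) = laxLoop u A := by
    intro t
    by_cases ht : t ∈ I
    · obtain ⟨A, hA, hA'⟩ :=
        exists_laxLoop_eq u hA₀ (h.plus_mem t ht) (h.minus_mem t ht) (h.Ad_eq ht)
      exact ⟨A, fun _ => ⟨hA, hA'⟩⟩
    · exact ⟨0, fun h => absurd h ht⟩
  choose A hA using hex
  refine ⟨A, ?_, fun t ht z => ?_, fun t ht => (hA t ht).1, fun t ht =>
    ⟨(hA t ht).2.symm, (hA t ht).2.symm.trans (h.Ad_eq ht)⟩⟩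
  · have h1 := (hA 0 h.zero_mem).2
    rw [h.plus_zero] at h1
    exact laxLoop_injective u (by rw [← h1]; simp [Ad])
  · have h1 := hasDerivAt_conj (X := laxLoop u A₀) (h.hasDerivAt_plus hu ha haf ht (hA t ht).2)
    have h2 : HasDerivAt (fun s => laxLoop u (A s))
        (-constLoop N (fun i j => ⁅A t, companion u f (A t)⁆ i j)) t := by
      rw [constLoop_lie hu]
      have h3 : (gp t : Loop N) * laxLoop u A₀ * ((gp t)⁻¹ : (Loop N)ˣ) = laxLoop u (A t) :=
        (hA t ht).2
      rw [h3] at h1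
      refine h1.congr_of_eventuallyEq ?_
      filter_upwards [h.isOpen.mem_nhds ht] with s hs
      exact (hA s hs).2.symm
    -- Evaluating at the single point `z = 1` recovers `A'`; since the bracket does not depend on
    -- `z`, the equation follows for every `z`.
    have h4 := (ContinuousMap.evalCLM ℝ (1 : Circle)).hasFDerivAt.comp_hasDerivAt t h2
    have h5 : HasDerivAt (fun s => (((1 : Circle) : ℂ) • Mu u - toComplex (A s)))
        (-toComplex ⁅A t, companion u f (A t)⁆) t := h4
    rw [lax_bracket hu]
    have h6 := (h5.const_sub (((1 : Circle) : ℂ) • Mu u)).sub_const (z • Mu u)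
    simpa using h6

end MarkovLax

end

open MarkovLax in
theorem theorem3p1 {N : ℕ} (u : Fin N → ℝ) (hu : StrictMono u)
    (f : ℝ → ℝ) (hf : ContDiff ℝ 1 f)
    (a : ℕ → ℝ) (ha : ∀ r : ℝ, Summable fun n => a n * r ^ n)
    (haf : ∀ i, HasSum (fun n => a n * u i ^ n) (f (u i)))
    (A₀ : Matrix (Fin N) (Fin N) ℝ) (hA₀ : A₀ ∈ markovAlgebra N) :
    ∃ G : Loop N,
      (∀ G' : Loop N, IsGradientAt (hamiltonian a) (laxLoop u A₀) G' ↔ G' = G) ∧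
      (∃ (I : Set ℝ) (gp gm : ℝ → (Loop N)ˣ), IsMaximalFactorization G I gp gm) ∧
      ∀ (I : Set ℝ) (gp gm : ℝ → (Loop N)ˣ), IsFactorization G I gp gm →
        ∃ A : ℝ → Matrix (Fin N) (Fin N) ℝ,
          A 0 = A₀ ∧ IsLaxSolution u f I A ∧ (∀ t ∈ I, A t ∈ markovAlgebra N) ∧
          (∀ t ∈ I, laxLoop u (A t) = Ad (gp t) (laxLoop u A₀) ∧
            laxLoop u (A t) = Ad (gm t) (laxLoop u A₀)) ∧
          ∀ (J : Set ℝ) (A' : ℝ → Matrix (Fin N) (Fin N) ℝ),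
            IsOpen J → J.OrdConnected → (0 : ℝ) ∈ J → IsLaxSolution u f J A' → A' 0 = A₀ →
            ∀ t ∈ I ∩ J, A' t = A t := by
  refine ⟨gradLoop a (laxLoop u A₀),
    isGradientAt_hamiltonian_iff ha (isRealLoop_laxLoop u A₀),
    exists_isMaximalFactorization (exists_isFactorization hu.injective ha haf A₀),
    fun I gp gm h => ?_⟩
  obtain ⟨A, hA0, hA, hmem, hAd⟩ := h.exists_isLaxSolution hu.injective ha haf hA₀
  exact ⟨A, hA0, hA, hmem, hAd, fun J A' _ hJ h0 hA' hA'0 t ht =>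
    hA.eq hu.injective hA' h.ordConnected hJ h.zero_mem h0 (hA'0.trans hA0.symm) ht⟩
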